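/- Let $k$ be an algebraically closed field of characteristic zero, $A$ a finitely generated commutative associative unital $k$-algebra, $X_{\mathrm{rat}}$ the set of rational points of $X=\operatorname{Spec}A$ (equivalently, of $k$-algebra homomorphisms $A\to k$), and $\mathfrak g$ a finite-dimensional semisimple Lie algebra over $k$. Let $\Gamma$ be a finite abelian group acting on $A$ (hence on $X_{\mathrm{rat}}$) by $k$-algebra automorphisms and on $\mathfrak g$ by Lie algebra automorphisms, such that $\Gamma$ acts freely on $X_{\mathrm{rat}}$. Let $(\mathfrak g\otimes A)^\Gamma$ be the Lie algebra of fixed points of the diagonal action of $\Gamma$ on $\mathfrak g\otimes A$. Fix a triangular decomposition $\mathfrak g=\mathfrak n^-\oplus\mathfrak h\oplus\mathfrak n^+$ with compatible Chevalley generators $e_i,h_i,f_i$ $(i\in I)$, and let $P^+$ be the set of dominant integral weights. An automorphism $\varphi$ of $\mathfrak g$ acts on $P^+$ through its outer part: writing $\varphi=\theta\delta$ with $\theta\in\operatorname{Int}\mathfrak g$ (the group generated by the $\exp(\operatorname{ad}y)$ with $\operatorname{ad}y$ nilpotent) and $\delta$ the diagram automorphism with $\delta(e_i)=e_{\sigma(i)}$,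 $\delta(f_i)=f_{\sigma(i)}$ for a permutation $\sigma$ of $I$, the weight $\varphi\cdot\mu$ is given by $(\varphi\cdot\mu)(h_{\sigma(i)})=\mu(h_i)$. Let $\mathcal E$ be the set of finitely supported functions $\psi:X_{\mathrm{rat}}\to P^+$, put $\operatorname{Supp}\psi=\{x:\psi(x)\ne0\}$, and let $\mathcal E^\Gamma\subseteq\mathcal E$ be the subset of $\Gamma$-equivariant functions, i.e. those with $\psi(\gamma\cdot x)=\gamma\cdot\psi(x)$ for all $\gamma\in\Gamma$, $x\in X_{\mathrm{rat}}$. For $\psi\in\mathcal E$, the (untwisted) local Weyl module $W(\psi)$ is the $(\mathfrak g\otimes A)$-module generated by a vector $w_\psi$ with defining relations $$(\mathfrak n^+\otimes A)\,w_\psi=0,\qquad (f_i\otimes1)^{\lambda(h_i)+1}w_\psi=0\ \ (i\in I),\qquad \alpha\, w_\psi=\Big(\sum_{x\in\operatorname{Supp}\psi}\psi(x)(\alpha(x))\Big)w_\psi\ \ (\alpha\in\mathfrak h\otimes A),$$ where $\lambda=\sum_{x\in\operatorname{Supp}\psi}\psi(x)$. For $\psi\in\mathcal E^\Gamma$, let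 $(\operatorname{Supp}\psi)_\Gamma$ be the set of subsets of $\operatorname{Supp}\psi$ containing exactly one point of each $\Gamma$-orbit in $\operatorname{Supp}\psi$, and for $\mathbf x\in(\operatorname{Supp}\psi)_\Gamma$ let $\psi_{\mathbf x}\in\mathcal E$ be the function equal to $\psi$ on $\mathbf x$ and to $0$ elsewhere. Proposition. Let $\psi\in\mathcal E^\Gamma$ and $\mathbf x,\mathbf x'\in(\operatorname{Supp}\psi)_\Gamma$. Then the restrictions of $W(\psi_{\mathbf x})$ and $W(\psi_{\mathbf x'})$ to $(\mathfrak g\otimes A)^\Gamma$ are isomorphic as $(\mathfrak g\otimes A)^\Gamma$-modules. Consequently the twisted local Weyl module $W_\Gamma(\psi)$, defined as the restriction of $W(\psi_{\mathbf x})$ to $(\mathfrak g\otimes A)^\Gamma$ for some choice of $\mathbf x\in(\operatorname{Supp}\psi)_\Gamma$, is well defined up to isomorphism: $(\operatorname{Supp}\psi)_\Gamma$ is not empty, and $W_\Gamma(\psi)$ is isomorphic to the restriction of $W(\psi_{\mathbf x})$ for every $\mathbf x\in(\operatorname{Supp}\psi)_\Gamma$. -/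

import Mathlib

open scoped TensorProduct

noncomputable section

namespace EMA

/-! ### Rational points, group actions, the equivariant map algebra -/

/-- The rational points of `X = Spec A`: a prime `𝔪` with `A / 𝔪 ≅ k` is the same thing as a
`k`-algebra homomorphism `x : A → k` (with kernel `𝔪`), and `x f` is the value of `f` at `x`. -/
abbrev RatPoint (k A : Type*) [Field k] [CommRing A] [Algebra k A] := A →ₐ[k] k

/-- The action of `Γ` on rational points: `(γ • x) f = x (γ⁻¹ • f)`, i.e. `𝔪_{γ • x} = γ • 𝔪_x`. -/
instance ratPointMulAction (Γ k A : Type*) [Field k] [CommRing A] [Algebra k A] [Group Γ]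
    [MulSemiringAction Γ A] [SMulCommClass Γ k A] : MulAction Γ (RatPoint k A) where
  smul γ x := x.comp (MulSemiringAction.toAlgHom k A γ⁻¹)
  one_smul x := by
    ext f
    change x ((1 : Γ)⁻¹ • f) = x f
    rw [inv_one, one_smul]
  mul_smul γ δ x := by
    ext f
    change x ((γ * δ)⁻¹ • f) = x (δ⁻¹ • γ⁻¹ • f)
    rw [mul_inv_rev, mul_smul]

/-- A linear action of `Γ` on a Lie algebra that is by Lie algebra automorphisms. -/
class IsLieAction (Γ 𝔤 : Type*) [Group Γ] [LieRing 𝔤] [DistribMulAction Γ 𝔤] : Prop where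
  smul_lie' : ∀ (γ : Γ) (y z : 𝔤), γ • ⁅y, z⁆ = ⁅γ • y, γ • z⁆

section Action

variable (k A 𝔤 : Type*) {Γ : Type*} [Field k] [CommRing A] [Algebra k A]
  [LieRing 𝔤] [LieAlgebra k 𝔤] [Group Γ]
  [MulSemiringAction Γ A] [SMulCommClass Γ k A]
  [DistribMulAction Γ 𝔤] [SMulCommClass Γ k 𝔤] [IsLieAction Γ 𝔤]

/-- The action of `γ` on `𝔤`, as a Lie algebra homomorphism. -/
def actLie (γ : Γ) : 𝔤 →ₗ⁅k⁆ 𝔤 :=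
  { DistribSMul.toLinearMap k 𝔤 γ with
    map_lie' := fun {y z} => IsLieAction.smul_lie' γ y z }

/-- The diagonal action of `γ` on `𝔤 ⊗ A` (written `A ⊗[k] 𝔤`). -/
def diagAct (γ : Γ) : A ⊗[k] 𝔤 →ₗ⁅k⁆ A ⊗[k] 𝔤 :=
  LieAlgebra.ExtendScalars.map (MulSemiringAction.toAlgHom k A γ) (actLie k 𝔤 γ)

variable (Γ)

/-- The equivariant map algebra `(𝔤 ⊗ A)^Γ`. -/
def equivariantMapAlgebra : LieSubalgebra k (A ⊗[k] 𝔤) where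
  carrier := {α | ∀ γ : Γ, diagAct k A 𝔤 γ α = α}
  add_mem' := fun ha hb γ => by rw [map_add, ha γ, hb γ]
  zero_mem' := fun γ => map_zero _
  smul_mem' := fun c α hα γ => by rw [map_smul, hα γ]
  lie_mem' := fun {α β} hα hβ γ => by
    have h1 : diagAct k A 𝔤 γ α = α := hα γ
    have h2 : diagAct k A 𝔤 γ β = β := hβ γ
    rw [LieHom.map_lie, h1, h2]

end Action

/-! ### Inner automorphisms, outer parts, dominant integral weights

The triangular decomposition of `𝔤`, together with Chevalley generators `e i`, `h i`, `f i`
compatible with it, is given by `b : LieAlgebra.Basis ι H`: the Cartan subalgebra is `H`, and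
`𝔫⁺ = b.borelUpper`, `𝔫⁻ = b.borelLower` are the subalgebras generated by the `e i`, resp. the
`f i`. -/

section Lie

variable (k 𝔤 : Type*) [Field k] [LieRing 𝔤] [LieAlgebra k 𝔤]

/-- The exponential of `ad y`, for `ad y` nilpotent. -/
def expAd (y : 𝔤) : 𝔤 →ₗ[k] 𝔤 :=
  ∑ n ∈ Finset.range (nilpotencyClass (LieAlgebra.ad k 𝔤 y)),
    ((n.factorial : k)⁻¹) • (LieAlgebra.ad k 𝔤 y : Module.End k 𝔤) ^ n

/-- The group `Int 𝔤` generated by the automorphisms `exp (ad y)` with `ad y` nilpotent. -/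
def innerAut : Subgroup (𝔤 ≃ₗ[k] 𝔤) :=
  Subgroup.closure
    {θ | ∃ y : 𝔤, IsNilpotent (LieAlgebra.ad k 𝔤 y) ∧ (θ : 𝔤 →ₗ[k] 𝔤) = expAd k 𝔤 y}

variable {k 𝔤} {ι : Type*} [Finite ι] {H : LieSubalgebra k 𝔤} (b : LieAlgebra.Basis ι H)

/-- `δ` is the diagram automorphism given by the permutation `σ` of the simple roots. -/
def IsDiagramAut (σ : Equiv.Perm ι) (δ : 𝔤 ≃ₗ⁅k⁆ 𝔤) : Prop :=
  ∀ i, δ (b.e i) = b.e (σ i) ∧ δ (b.f i) = b.f (σ i)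

/-- The automorphism `φ` of `𝔤` has as outer part, with respect to `Aut 𝔤 = Int 𝔤 ⋊ Out 𝔤`, the
diagram automorphism given by `σ`. -/
def IsOuterPart (φ : 𝔤 → 𝔤) (σ : Equiv.Perm ι) : Prop :=
  ∃ δ : 𝔤 ≃ₗ⁅k⁆ 𝔤, IsDiagramAut b σ δ ∧ ∃ θ ∈ innerAut k 𝔤, ∀ y, φ y = θ (δ y)

/-- The set `P⁺` of dominant integral weights. -/
def dominantWeights : AddSubmonoid (Module.Dual k H) where
  carrier := {μ | ∀ i, ∃ n : ℕ, μ (b.h' i) = n}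
  zero_mem' := fun i => ⟨0, by simp⟩
  add_mem' := fun {μ ν} hμ hν i => by
    obtain ⟨m, hm⟩ := hμ i
    obtain ⟨n, hn⟩ := hν i
    exact ⟨m + n, by simp [hm, hn]⟩

/-- `ν = φ_Out · μ`, where `φ_Out` is the outer part of the automorphism `φ`; a diagram
automorphism acts on weights by permuting the values on the simple coroots. -/
def IsOuterTranslate (φ : 𝔤 → 𝔤) (μ ν : dominantWeights b) : Prop :=
  ∃ σ : Equiv.Perm ι, IsOuterPart b φ σ ∧
    ∀ i, (ν : Module.Dual k H) (b.h' (σ i)) = (μ : Module.Dual k H) (b.h' i)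

end Lie

/-! ### The sets `ℰ` and `ℰ^Γ`, orbit representatives, Weyl modules -/

section Weyl

variable {k 𝔤 : Type*} [Field k] [LieRing 𝔤] [LieAlgebra k 𝔤]
  {ι : Type*} [Finite ι] {H : LieSubalgebra k 𝔤} (b : LieAlgebra.Basis ι H)
  {A : Type*} [CommRing A] [Algebra k A]

variable (A) in
/-- The set `ℰ` of finitely supported functions from the rational points to `P⁺`. -/
abbrev WeightFun := RatPoint k A →₀ dominantWeights b

variable {b}

/-- `ψ ∈ ℰ^Γ`, i.e. `ψ (γ • x) = γ · ψ x`, where `Γ` acts on `P⁺` through outer parts. -/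
def IsEquivariant (Γ : Type*) [Group Γ] [MulSemiringAction Γ A] [SMulCommClass Γ k A]
    [DistribMulAction Γ 𝔤] (ψ : WeightFun b A) : Prop :=
  ∀ (γ : Γ) (x : RatPoint k A), IsOuterTranslate b (fun y => γ • y) (ψ x) (ψ (γ • x))

/-- For a `Γ`-invariant set `Y`, the subsets of `Y` containing exactly one point of each `Γ`-orbit
in `Y`. -/
def orbitReps (Γ : Type*) {X : Type*} [Group Γ] [MulAction Γ X] (Y : Set X) : Set (Set X) :=
  {s | s ⊆ Y ∧ ∀ y ∈ Y, ∃! x, x ∈ s ∧ x ∈ MulAction.orbit Γ y}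

/-- The set of points where `ψ` does not vanish. -/
def Supp (ψ : WeightFun b A) : Set (RatPoint k A) := {x | ψ x ≠ 0}

open Classical in
/-- `ψ_s`: equal to `ψ` on `s` and `0` elsewhere. -/
def restrictTo (ψ : WeightFun b A) (s : Set (RatPoint k A)) : WeightFun b A :=
  ψ.filter (fun x => x ∈ s)

/-- `wt ψ = ∑ ψ x`. -/
def wt (ψ : WeightFun b A) : dominantWeights b := ψ.sum fun _ μ => μ

/-- The defining relations of the cyclic vector `w` of the local Weyl module:
`(𝔫⁺ ⊗ A) w = 0`, `(f i ⊗ 1) ^ (λ (h i) + 1) w = 0` with `λ = wt ψ`, and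
`α w = (∑ x, ψ x (α x)) w` for `α ∈ 𝔥 ⊗ A` (it is enough to let `α` be a pure tensor). -/
def weylRelations (ψ : WeightFun b A) : Set (UniversalEnvelopingAlgebra k (A ⊗[k] 𝔤)) :=
  {u | ∃ a : A, ∃ y ∈ b.borelUpper, u = UniversalEnvelopingAlgebra.ι k (a ⊗ₜ[k] y)} ∪
  {u | ∃ (i : ι) (n : ℕ), (wt ψ : Module.Dual k H) (b.h' i) = n ∧
    u = UniversalEnvelopingAlgebra.ι k ((1 : A) ⊗ₜ[k] b.f i) ^ (n + 1)} ∪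
  {u | ∃ (a : A) (h : H), u = UniversalEnvelopingAlgebra.ι k (a ⊗ₜ[k] (h : 𝔤)) -
    algebraMap k (UniversalEnvelopingAlgebra k (A ⊗[k] 𝔤))
      (ψ.sum fun x μ => x a * (μ : Module.Dual k H) h)}

/-- The untwisted local Weyl module `W(ψ)`: the `(𝔤 ⊗ A)`-module with one generator, subject to
the relations above, i.e. the quotient of `U(𝔤 ⊗ A)` by the left ideal they generate. -/
def WeylModule (ψ : WeightFun b A) : Type _ :=
  UniversalEnvelopingAlgebra k (A ⊗[k] 𝔤) ⧸
    Submodule.span (UniversalEnvelopingAlgebra k (A ⊗[k] 𝔤)) (weylRelations ψ)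

variable (ψ : WeightFun b A)

instance : AddCommGroup (WeylModule ψ) :=
  inferInstanceAs (AddCommGroup (UniversalEnvelopingAlgebra k (A ⊗[k] 𝔤) ⧸
    Submodule.span (UniversalEnvelopingAlgebra k (A ⊗[k] 𝔤)) (weylRelations ψ)))

instance : Module (UniversalEnvelopingAlgebra k (A ⊗[k] 𝔤)) (WeylModule ψ) :=
  inferInstanceAs (Module (UniversalEnvelopingAlgebra k (A ⊗[k] 𝔤))
    (UniversalEnvelopingAlgebra k (A ⊗[k] 𝔤) ⧸
      Submodule.span (UniversalEnvelopingAlgebra k (A ⊗[k] 𝔤)) (weylRelations ψ)))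

instance : Module k (WeylModule ψ) :=
  inferInstanceAs (Module k (UniversalEnvelopingAlgebra k (A ⊗[k] 𝔤) ⧸
    Submodule.span (UniversalEnvelopingAlgebra k (A ⊗[k] 𝔤)) (weylRelations ψ)))

instance : IsScalarTower k (UniversalEnvelopingAlgebra k (A ⊗[k] 𝔤)) (WeylModule ψ) :=
  inferInstanceAs (IsScalarTower k (UniversalEnvelopingAlgebra k (A ⊗[k] 𝔤))
    (UniversalEnvelopingAlgebra k (A ⊗[k] 𝔤) ⧸
      Submodule.span (UniversalEnvelopingAlgebra k (A ⊗[k] 𝔤)) (weylRelations ψ)))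

attribute [local instance 100] LieRing.ofAssociativeRing in
theorem ι_lie (α β : A ⊗[k] 𝔤) :
    UniversalEnvelopingAlgebra.ι k ⁅α, β⁆ =
      UniversalEnvelopingAlgebra.ι k α * UniversalEnvelopingAlgebra.ι k β -
        UniversalEnvelopingAlgebra.ι k β * UniversalEnvelopingAlgebra.ι k α := by
  rw [LieHom.map_lie, LieRing.of_associative_ring_bracket]

instance : LieRingModule (A ⊗[k] 𝔤) (WeylModule ψ) where
  bracket α m := UniversalEnvelopingAlgebra.ι k α • m
  add_lie α β m := by
    change UniversalEnvelopingAlgebra.ι k (α + β) • m = _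
    rw [map_add, add_smul]
  lie_add α m n := smul_add _ m n
  leibniz_lie α β m := by
    change UniversalEnvelopingAlgebra.ι k α • UniversalEnvelopingAlgebra.ι k β • m =
      UniversalEnvelopingAlgebra.ι k ⁅α, β⁆ • m +
        UniversalEnvelopingAlgebra.ι k β • UniversalEnvelopingAlgebra.ι k α • m
    rw [ι_lie, sub_smul, mul_smul, mul_smul, sub_add_cancel]

instance : LieModule k (A ⊗[k] 𝔤) (WeylModule ψ) where
  smul_lie c α m := by
    change UniversalEnvelopingAlgebra.ι k (c • α) • m = c • UniversalEnvelopingAlgebra.ι k α • m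
    rw [map_smul, smul_assoc]
  lie_smul c α m := by
    change UniversalEnvelopingAlgebra.ι k α • c • m = c • UniversalEnvelopingAlgebra.ι k α • m
    rw [← algebraMap_smul (UniversalEnvelopingAlgebra k (A ⊗[k] 𝔤)) c m,
      ← algebraMap_smul (UniversalEnvelopingAlgebra k (A ⊗[k] 𝔤)) c
        (UniversalEnvelopingAlgebra.ι k α • m), ← mul_smul, ← mul_smul, Algebra.commutes]

/-- The twisted local Weyl module `W_Γ(ψ)`: the module `W(ψ_s)`, for some choice of a set `s` of
representatives of the orbits in the support of `ψ`. It is regarded as a module over the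
equivariant map algebra by restriction (Lie modules restrict to Lie subalgebras by instance). -/
abbrev TwistedWeylModule (Γ : Type*) [Group Γ] [MulSemiringAction Γ A] [SMulCommClass Γ k A]
    (ψ : WeightFun b A) : Type _ :=
  WeylModule (restrictTo ψ (Classical.epsilon fun s => s ∈ orbitReps Γ (Supp ψ)))

end Weyl

end EMA

end

/-! It suffices to move one point of the support from `x` to `γ • x`, since any two systems of orbit
representatives of a finite support are joined by such moves (`nonempty_equiv_restrictTo`). Let ψ₁
and ψ₂ be the weight functions before and after a move.

A power of the ideal of functions vanishing on the support annihilates a local Weyl module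
(`exists_pow_supportIdeal_annihilates`). Modulo that power, a function `e` equal to 1 at the moved
point and 0 on the rest of the support can be chosen idempotent, so the action can be altered at one
point and left alone at the others. This is `twist`, which sends α to (1 - e) α + e (g ⊗ θ) α. When
g and θ are both given by γ, the twist fixes every element of (𝔤 ⊗ A)^Γ (`twist_actLie_of_mem`).
Hence a linear bijection W(ψ₁) → W(ψ₂) that turns the action of α into that of its twist is an
isomorphism over (𝔤 ⊗ A)^Γ.

Write the action of γ on 𝔤 as θ δ, with θ inner and δ a diagram automorphism. Since δ preserves 𝔫⁺
and permutes the Chevalley generators, the generator of W(ψ₂) satisfies the relations of W(ψ₁) for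
the action twisted by δ. This gives a map, and the same construction with γ⁻¹ and δ⁻¹ gives its
inverse (`exists_twisted_linearMap`, `comp_eq_id_of_semilinear`). The inner part exp(ad y),
concentrated at one point, is implemented on W(ψ₂) by exp(e ⊗ y)
(`exists_linearEquiv_of_mem_innerAut`). That exponential exists because local Weyl modules are
integrable and ad-nilpotent elements act locally nilpotently on integrable modules
(`isLocallyNilpotent_of_integrable`); finite-dimensionality of the Weyl module is not needed. -/

namespace EMA

/-! ### Exponentials of locally nilpotent operators. -/

section LocallyNilpotent

open Finset

variable {k V : Type*} [Field k] [AddCommGroup V] [Module k V]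

/-- Every vector is killed by a power of `D`. -/
def IsLocallyNilpotent (D : Module.End k V) : Prop := ∀ v, ∃ n : ℕ, (D ^ n) v = 0

theorem pow_apply_eq_zero_of_le {D : Module.End k V} {v : V} {m n : ℕ} (hmn : m ≤ n)
    (h : (D ^ m) v = 0) : (D ^ n) v = 0 := by
  rw [← Nat.sub_add_cancel hmn, pow_add, Module.End.mul_apply, h, map_zero]

theorem IsLocallyNilpotent.of_isNilpotent {D : Module.End k V} (h : IsNilpotent D) :
    IsLocallyNilpotent D := fun v => by
  obtain ⟨n, hn⟩ := h
  exact ⟨n, by rw [hn, LinearMap.zero_apply]⟩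

theorem IsLocallyNilpotent.smul {D : Module.End k V} (h : IsLocallyNilpotent D) (t : k) :
    IsLocallyNilpotent (t • D) := fun v => by
  obtain ⟨n, hn⟩ := h v
  exact ⟨n, by rw [smul_pow, LinearMap.smul_apply, hn, smul_zero]⟩

theorem IsLocallyNilpotent.neg {D : Module.End k V} (h : IsLocallyNilpotent D) :
    IsLocallyNilpotent (-D) := by
  simpa using h.smul (-1)

theorem IsLocallyNilpotent.add_of_commute {D D' : Module.End k V} (h : IsLocallyNilpotent D)
    (h' : IsLocallyNilpotent D') (hc : Commute D D') : IsLocallyNilpotent (D + D') := fun v => by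
  obtain ⟨m, hm⟩ := h v
  obtain ⟨n, hn⟩ := h' v
  refine ⟨m + n, ?_⟩
  rw [hc.add_pow', LinearMap.sum_apply]
  refine sum_eq_zero fun p hp => ?_
  rw [HasAntidiagonal.mem_antidiagonal] at hp
  rw [LinearMap.smul_apply]
  rcases le_or_gt m p.1 with h1 | h1
  · rw [(hc.pow_pow p.1 p.2).eq, Module.End.mul_apply, pow_apply_eq_zero_of_le h1 hm, map_zero,
      smul_zero]
  · rw [Module.End.mul_apply, pow_apply_eq_zero_of_le (by omega : n ≤ p.2) hn, map_zero, smul_zero]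

theorem IsLocallyNilpotent.conj {D : Module.End k V} (h : IsLocallyNilpotent D)
    {D' : Module.End k V} (T : V ≃ₗ[k] V) (hT : ∀ v, T (D v) = D' (T v)) : IsLocallyNilpotent D' := fun v => by
  have hpow : ∀ (n : ℕ) (u : V), T ((D ^ n) u) = (D' ^ n) (T u) := by
    intro n
    induction n with
    | zero => intro u; simp
    | succ n ih => intro u; rw [pow_succ', pow_succ', Module.End.mul_apply, hT, ih,
        Module.End.mul_apply]
  obtain ⟨n, hn⟩ := h (T.symm v)
  exact ⟨n, by rw [← T.apply_symm_apply v, ← hpow, hn, map_zero]⟩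

open Classical in
/-- The value at `v` of the exponential of a locally nilpotent operator. -/
noncomputable def expApply {D : Module.End k V} (hD : IsLocallyNilpotent D) (v : V) : V :=
  ∑ n ∈ range (Nat.find (hD v)), ((n.factorial : k)⁻¹) • (D ^ n) v

theorem expApply_eq_sum {D : Module.End k V} (hD : IsLocallyNilpotent D) {v : V} {N : ℕ}
    (h : (D ^ N) v = 0) :
    expApply hD v = ∑ n ∈ range N, ((n.factorial : k)⁻¹) • (D ^ n) v := by
  classical
  refine sum_subset (range_subset_range.2 (Nat.find_min' (hD v) h)) fun n _ hn => ?_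
  rw [pow_apply_eq_zero_of_le (not_lt.1 fun hlt => hn (mem_range.2 hlt)) (Nat.find_spec (hD v)),
    smul_zero]

/-- The exponential of a locally nilpotent operator. -/
noncomputable def locExp {D : Module.End k V} (hD : IsLocallyNilpotent D) : Module.End k V where
  toFun := expApply hD
  map_add' u v := by
    obtain ⟨m, hm⟩ := hD u
    obtain ⟨n, hn⟩ := hD v
    have hu := pow_apply_eq_zero_of_le (le_max_left m n) hm
    have hv := pow_apply_eq_zero_of_le (le_max_right m n) hn
    rw [expApply_eq_sum hD hu, expApply_eq_sum hD hv,
      expApply_eq_sum hD (N := max m n) (by rw [map_add, hu, hv, add_zero]), ← sum_add_distrib]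
    simp
  map_smul' c v := by
    obtain ⟨m, hm⟩ := hD v
    rw [expApply_eq_sum hD hm, expApply_eq_sum hD (N := m) (by rw [map_smul, hm, smul_zero]),
      RingHom.id_apply, smul_sum]
    exact sum_congr rfl fun n _ => by rw [map_smul, smul_comm]

theorem locExp_apply {D : Module.End k V} (hD : IsLocallyNilpotent D) {v : V} {N : ℕ}
    (h : (D ^ N) v = 0) :
    locExp hD v = ∑ n ∈ range N, ((n.factorial : k)⁻¹) • (D ^ n) v := expApply_eq_sum hD h

/-- The triangle of total degree below 2N contains the N × N square, and `f` vanishes off the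
square. This is how a product of two truncated exponentials becomes one truncated series. -/
theorem sum_range_sum_antidiagonal {M : Type*} [AddCommMonoid M] (N : ℕ) (f : ℕ × ℕ → M)
    (hf : ∀ p, N ≤ p.1 ∨ N ≤ p.2 → f p = 0) :
    ∑ n ∈ range (N + N), ∑ p ∈ antidiagonal n, f p = ∑ p ∈ range N ×ˢ range N, f p := by
  rw [← sum_fiberwise_of_maps_to (s := range N ×ˢ range N) (t := range (N + N))
    (g := fun p => p.1 + p.2)]
  · refine sum_congr rfl fun n _ => (sum_subset (fun p hp => ?_) fun p hp hp' => hf p ?_).symm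
    · simpa using (mem_filter.1 hp).2
    · by_contra! hc
      exact hp' (mem_filter.2 ⟨mem_product.2 ⟨mem_range.2 hc.1, mem_range.2 hc.2⟩, by simpa using hp⟩)
  · intro p hp
    simp only [mem_product, mem_range] at hp ⊢
    omega

variable [CharZero k]

theorem inv_factorial_mul_choose {p : ℕ × ℕ} {n : ℕ} (hp : p.1 + p.2 = n) :
    (n.factorial : k)⁻¹ * n.choose p.1 = (p.1.factorial : k)⁻¹ * (p.2.factorial : k)⁻¹ := by
  have h1 : (n.factorial : k) ≠ 0 := Nat.cast_ne_zero.2 n.factorial_ne_zero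
  have h2 : (p.1.factorial : k) ≠ 0 := Nat.cast_ne_zero.2 p.1.factorial_ne_zero
  have h3 : (p.2.factorial : k) ≠ 0 := Nat.cast_ne_zero.2 p.2.factorial_ne_zero
  have h4 : (n.choose p.1 : k) * p.1.factorial * p.2.factorial = n.factorial := by
    subst hp
    rw [Nat.choose_symm_add]
    exact_mod_cast Nat.add_choose_mul_factorial_mul_factorial p.1 p.2
  field_simp
  rw [← h4]

/-- The Leibniz rule for powers of `x`, divided by factorials, is the Cauchy product of two
exponential series. So conjugation by exp(x) on `V` realises exp(ad x) on `L`. -/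
theorem locExp_lie {L : Type*} [LieRing L] [LieAlgebra k L] [LieRingModule L V] [LieModule k L V]
    {x : L} (hL : IsLocallyNilpotent (LieAlgebra.ad k L x))
    (hV : IsLocallyNilpotent (LieModule.toEnd k L V x)) (z : L) (v : V) :
    locExp hV ⁅z, v⁆ = ⁅locExp hL z, locExp hV v⁆ := by
  have key : ∀ n : ℕ, ((n.factorial : k)⁻¹) • (LieModule.toEnd k L V x ^ n) ⁅z, v⁆ =
      ∑ p ∈ HasAntidiagonal.antidiagonal n, ⁅((p.1.factorial : k)⁻¹) • (LieAlgebra.ad k L x ^ p.1) z,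
        ((p.2.factorial : k)⁻¹) • (LieModule.toEnd k L V x ^ p.2) v⁆ := by
    intro n
    rw [LieModule.toEnd_pow_lie, smul_sum]
    refine sum_congr rfl fun p hp => ?_
    rw [HasAntidiagonal.mem_antidiagonal] at hp
    rw [lie_smul, smul_lie, ← Nat.cast_smul_eq_nsmul k, smul_smul, smul_smul,
      inv_factorial_mul_choose hp, mul_comm]
  obtain ⟨m, hm⟩ := hL z
  obtain ⟨n, hn⟩ := hV v
  have hu := pow_apply_eq_zero_of_le (le_max_left m n) hm
  have hv := pow_apply_eq_zero_of_le (le_max_right m n) hn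
  set N := max m n
  have hN : (LieModule.toEnd k L V x ^ (N + N)) ⁅z, v⁆ = 0 := by
    rw [LieModule.toEnd_pow_lie]
    refine sum_eq_zero fun p hp => ?_
    rw [HasAntidiagonal.mem_antidiagonal] at hp
    rcases le_or_gt N p.1 with h1 | h1
    · rw [pow_apply_eq_zero_of_le h1 hu, zero_lie, smul_zero]
    · rw [pow_apply_eq_zero_of_le (by omega : N ≤ p.2) hv, lie_zero, smul_zero]
  rw [locExp_apply hV hN, locExp_apply hL hu, locExp_apply hV hv]
  simp_rw [key]
  rw [sum_range_sum_antidiagonal, sum_product, sum_lie_sum]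
  rintro p (hp | hp)
  · rw [pow_apply_eq_zero_of_le hp hu, smul_zero, zero_lie]
  · rw [pow_apply_eq_zero_of_le hp hv, smul_zero, lie_zero]

theorem locExp_neg_apply_locExp {D : Module.End k V} (h : IsLocallyNilpotent D)
    (h' : IsLocallyNilpotent (-D)) (v : V) : locExp h' (locExp h v) = v := by
  obtain ⟨N, hN⟩ := h v
  -- With `N + 1` the degree 0 term is in range even if `N = 0`; it is the only one that survives,
  -- the degree `n` part being a multiple of (-1 + 1) ^ n.
  have hN' : (D ^ (N + 1)) v = 0 := pow_apply_eq_zero_of_le N.le_succ hN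
  have hD : ∀ n : ℕ, ((-D) ^ n) = ((-1 : k) ^ n) • D ^ n := fun n => by
    rw [← smul_pow, neg_one_smul]
  have h1 : ((-D) ^ (N + 1)) (locExp h v) = 0 := by
    rw [locExp_apply h hN', map_sum]
    refine sum_eq_zero fun n _ => ?_
    rw [hD, LinearMap.smul_apply, map_smul, ← Module.End.mul_apply, ← pow_add,
      pow_apply_eq_zero_of_le (by omega) hN', smul_zero, smul_zero]
  rw [locExp_apply h' h1, locExp_apply h hN']
  have h2 : ∑ j ∈ range (N + 1), ((j.factorial : k)⁻¹) • ((-D) ^ j)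
      (∑ i ∈ range (N + 1), ((i.factorial : k)⁻¹) • (D ^ i) v) =
      ∑ n ∈ range (N + 1 + (N + 1)), ∑ p ∈ antidiagonal n,
        (((p.1.factorial : k)⁻¹) * ((-1) ^ p.1 * ((p.2.factorial : k)⁻¹))) •
          (D ^ (p.1 + p.2)) v := by
    rw [sum_range_sum_antidiagonal, sum_product]
    · refine sum_congr rfl fun j _ => ?_
      rw [map_sum, smul_sum]
      refine sum_congr rfl fun i _ => ?_
      rw [hD, LinearMap.smul_apply, map_smul, pow_add, Module.End.mul_apply, smul_smul, smul_smul,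
        mul_assoc]
    · rintro p hp
      rw [pow_apply_eq_zero_of_le (by omega) hN', smul_zero]
  have h3 : ∀ n : ℕ, ∑ p ∈ antidiagonal n,
      (((p.1.factorial : k)⁻¹) * ((-1) ^ p.1 * ((p.2.factorial : k)⁻¹))) • (D ^ (p.1 + p.2)) v =
      if n = 0 then v else 0 := by
    intro n
    have h4 : ∑ p ∈ antidiagonal n,
        (((p.1.factorial : k)⁻¹) * ((-1) ^ p.1 * ((p.2.factorial : k)⁻¹))) =
        (n.factorial : k)⁻¹ * (-1 + 1) ^ n := by
      rw [(Commute.all (-1 : k) 1).add_pow', mul_sum]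
      refine sum_congr rfl fun p hp => ?_
      rw [HasAntidiagonal.mem_antidiagonal] at hp
      rw [nsmul_eq_mul, one_pow, mul_one, ← mul_assoc (_⁻¹) (n.choose p.1 : k),
        inv_factorial_mul_choose hp]
      ring
    rw [sum_congr rfl (g := fun p => (((p.1.factorial : k)⁻¹) *
      ((-1) ^ p.1 * ((p.2.factorial : k)⁻¹))) • (D ^ n) v) fun p hp => by
        rw [HasAntidiagonal.mem_antidiagonal.1 hp], ← sum_smul, h4]
    split_ifs with hn
    · simp [hn]
    · simp [hn]
  rw [h2]
  simp_rw [h3]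
  simp

/-- The exponential of a locally nilpotent operator, as an automorphism. -/
noncomputable def locExpEquiv {D : Module.End k V} (h : IsLocallyNilpotent D) : V ≃ₗ[k] V :=
  LinearEquiv.ofLinearMap (locExp h) (locExp h.neg)
    (by
      ext v
      have h' : IsLocallyNilpotent (- -D) := by rwa [neg_neg]
      have := locExp_neg_apply_locExp h.neg h' v
      simp only [neg_neg] at this
      exact this)
    (by ext v; exact locExp_neg_apply_locExp h h.neg v)

theorem locExpEquiv_apply {D : Module.End k V} (h : IsLocallyNilpotent D) (v : V) :
    locExpEquiv h v = locExp h v := rfl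

end LocallyNilpotent

/-! ### Local finiteness, and nilpotency from vanishing traces. -/

section Integrable

open LieModule

attribute [local instance 100] LieRing.ofAssociativeRing

variable {k L V : Type*} [Field k] [LieRing L] [LieAlgebra k L]
  [AddCommGroup V] [Module k V] [LieRingModule L V] [LieModule k L V]

/-- Conjugation by the exponential of a locally nilpotent element preserves local nilpotency. -/
theorem isLocallyNilpotent_toEnd_locExp [CharZero k] {x y : L}
    (hL : IsLocallyNilpotent (LieAlgebra.ad k L x))
    (hx : IsLocallyNilpotent (toEnd k L V x)) (hy : IsLocallyNilpotent (toEnd k L V y)) :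
    IsLocallyNilpotent (toEnd k L V (locExp hL y)) :=
  hy.conj (locExpEquiv hx) fun v => locExp_lie hL hx y v

/-- A subspace that contains all `exp (t D) v` contains `D v`. -/
theorem apply_mem_of_forall_locExp_mem [CharZero k] {D : Module.End k V}
    (h : ∀ t : k, IsLocallyNilpotent (t • D))
    (N : Submodule k V) (v : V) (hv : ∀ t, locExp (h t) v ∈ N) : D v ∈ N := by
  by_contra hD
  -- For a functional φ that kills `N` but not `D v`, φ(exp(tD) v) is a polynomial in `t` vanishing
  -- on the infinite field `k`, and its linear coefficient is φ(D v). The bound `n + 2` below keeps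
  -- that coefficient in range.
  obtain ⟨φ, hφ, hN⟩ := Submodule.exists_le_ker_of_notMem hD
  obtain ⟨n, hn⟩ := h 1 v
  rw [one_smul] at hn
  have hn2 : (D ^ (n + 2)) v = 0 := pow_apply_eq_zero_of_le (by omega) hn
  let p : Polynomial k := ∑ i ∈ Finset.range (n + 2),
    Polynomial.monomial i ((i.factorial : k)⁻¹ * φ ((D ^ i) v))
  have hp : p = 0 := Polynomial.funext fun t => by
    have h1 : φ (locExp (h t) v) = 0 := hN (hv t)
    rw [locExp_apply (h t) (N := n + 2) (by rw [smul_pow, LinearMap.smul_apply, hn2, smul_zero]),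
      map_sum] at h1
    rw [Polynomial.eval_zero, ← h1, Polynomial.eval_finsetSum]
    refine Finset.sum_congr rfl fun i _ => ?_
    rw [Polynomial.eval_monomial, smul_pow, LinearMap.smul_apply, map_smul, map_smul, smul_eq_mul,
      smul_eq_mul]
    ring
  have h1 : p.coeff 1 = φ (D v) := by
    simp [p, Polynomial.finsetSum_coeff, Polynomial.coeff_monomial]
  exact hφ (by rw [← h1, hp, Polynomial.coeff_zero])

/-- A Lie algebra generated by ad-nilpotent elements acting locally nilpotently is spanned by
elements acting locally nilpotently. -/
theorem span_isLocallyNilpotent_eq_top [CharZero k] {s : Set L}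
    (hs : LieSubalgebra.lieSpan k L s = ⊤)
    (had : ∀ x ∈ s, IsNilpotent (LieAlgebra.ad k L x))
    (hV : ∀ x ∈ s, IsLocallyNilpotent (toEnd k L V x)) :
    Submodule.span k {x : L | IsLocallyNilpotent (toEnd k L V x)} = ⊤ := by
  set N := Submodule.span k {x : L | IsLocallyNilpotent (toEnd k L V x)} with hN
  -- `N` is stable under exp(t ad x) for all `t`, because this conjugates locally nilpotent
  -- operators; differentiating at `t = 0` makes it stable under ad x.
  have key : ∀ x ∈ s, ∀ y ∈ N, ⁅x, y⁆ ∈ N := by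
    intro x hx y hy
    have hadt : ∀ t : k, IsLocallyNilpotent (t • LieAlgebra.ad k L x) := fun t =>
      (IsLocallyNilpotent.of_isNilpotent (had x hx)).smul t
    refine apply_mem_of_forall_locExp_mem hadt N y fun t => ?_
    have hadt' : IsLocallyNilpotent (LieAlgebra.ad k L (t • x)) := by rw [map_smul]; exact hadt t
    have heq : locExp (hadt t) = locExp hadt' := by
      congr 1; rw [map_smul]
    have hle : N ≤ N.comap (locExp (hadt t)) := by
      refine Submodule.span_le.2 fun z hz => Submodule.subset_span ?_
      rw [heq]
      exact isLocallyNilpotent_toEnd_locExp (k := k) (V := V) hadt' (by rw [map_smul]; exact (hV x hx).smul t) hz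
    exact hle hy
  have key' : ∀ x y : L, y ∈ N → ⁅x, y⁆ ∈ N := by
    intro x
    have hx : x ∈ LieSubalgebra.lieSpan k L s := by rw [hs]; trivial
    induction hx using LieSubalgebra.lieSpan_induction with
    | mem x hx => exact key x hx
    | zero => intro y _; rw [zero_lie]; exact N.zero_mem
    | add x z _ _ hx hz => intro y hy; rw [add_lie]; exact N.add_mem (hx y hy) (hz y hy)
    | smul t x _ hx => intro y hy; rw [smul_lie]; exact N.smul_mem t (hx y hy)
    | lie x z _ _ hx hz =>
      intro y hy
      rw [lie_lie]
      exact N.sub_mem (hx _ (hz y hy)) (hz _ (hx y hy))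
  refine eq_top_iff.2 fun x _ => ?_
  have hx : x ∈ LieSubalgebra.lieSpan k L s := by rw [hs]; trivial
  induction hx using LieSubalgebra.lieSpan_induction with
  | mem x hx => exact Submodule.subset_span (hV x hx)
  | zero => exact N.zero_mem
  | add x z _ _ hx hz => exact N.add_mem (hx trivial) (hz trivial)
  | smul t x _ hx => exact N.smul_mem t (hx trivial)
  | lie x z _ _ _ hz => exact key' x z (hz trivial)

/-- A finite spanning set of `G` is killed by one common power of `D`, so only finitely many of the
images are nonzero. -/
theorem finiteDimensional_iSup_map_pow {D : Module.End k V} (hD : IsLocallyNilpotent D)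
    (G : Submodule k V) [FiniteDimensional k G] :
    FiniteDimensional k (⨆ n : ℕ, G.map (D ^ n) : Submodule k V) := by
  obtain ⟨t, ht⟩ := (Submodule.fg_iff_finiteDimensional G).2 inferInstance
  choose n hn using hD
  let N := t.sup n
  have h0 : ∀ v ∈ G, (D ^ N) v = 0 := by
    have : G ≤ LinearMap.ker (D ^ N) := by
      rw [← ht, Submodule.span_le]
      exact fun v hv => pow_apply_eq_zero_of_le (Finset.le_sup hv) (hn v)
    exact this
  have hle : (⨆ n : ℕ, G.map (D ^ n)) ≤ ⨆ n : Fin N, G.map (D ^ (n : ℕ)) := by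
    refine iSup_le fun m => ?_
    rcases lt_or_ge m N with h | h
    · exact le_iSup (fun n : Fin N => G.map (D ^ (n : ℕ))) ⟨m, h⟩
    · rintro _ ⟨v, hv, rfl⟩
      rw [pow_apply_eq_zero_of_le h (h0 v hv)]
      exact Submodule.zero_mem _
  exact Submodule.finiteDimensional_of_le hle

/-- The span of the ordered monomials in a list of operators, applied to a vector. -/
def orderedMonomials (v : V) : List (Module.End k V) → Submodule k V
  | [] => Submodule.span k {v}
  | D :: l => ⨆ n : ℕ, (orderedMonomials v l).map (D ^ n)

theorem finiteDimensional_orderedMonomials (v : V) (l : List (Module.End k V))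
    (hl : ∀ D ∈ l, IsLocallyNilpotent D) : FiniteDimensional k (orderedMonomials v l) := by
  induction l with
  | nil => exact inferInstanceAs (FiniteDimensional k (Submodule.span k {v}))
  | cons D l ih =>
    have := ih fun D' hD' => hl D' (List.mem_cons_of_mem _ hD')
    exact finiteDimensional_iSup_map_pow (hl D List.mem_cons_self) _

theorem prod_pow_mem_orderedMonomials {ι : Type*} (v : V) (x : ι → Module.End k V) (c : ι → ℕ)
    (l : List ι) : (l.map fun i => x i ^ c i).prod v ∈ orderedMonomials v (l.map x) := by
  induction l with
  | nil => exact Submodule.mem_span_singleton_self v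
  | cons i l ih =>
    rw [List.map_cons (f := fun i => x i ^ c i), List.prod_cons, Module.End.mul_apply]
    exact Submodule.mem_iSup_of_mem (c i) (Submodule.mem_map_of_mem ih)

/-- The span of the vectors `x₁ ⋯ xₘ v` with `m < n`. -/
def monomialFiltration {ι : Type*} (x : ι → L) (v : V) (n : ℕ) : Submodule k V :=
  Submodule.span k {u | ∃ l : List ι, l.length < n ∧
    u = (l.map fun i => toEnd k L V (x i)).prod v}

theorem lie_mem_monomialFiltration {ι : Type*} {x : ι → L}
    (hx : Submodule.span k (Set.range x) = ⊤) (v : V) {n : ℕ} {u : V}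
    (hu : u ∈ monomialFiltration (k := k) x v n) (y : L) :
    ⁅y, u⁆ ∈ monomialFiltration (k := k) x v (n + 1) := by
  have hy : y ∈ Submodule.span k (Set.range x) := by rw [hx]; trivial
  induction hy using Submodule.span_induction with
  | mem y hy =>
    obtain ⟨i, rfl⟩ := hy
    have hle : monomialFiltration (k := k) x v n ≤
        (monomialFiltration (k := k) x v (n + 1)).comap (toEnd k L V (x i)) := by
      refine Submodule.span_le.2 ?_
      rintro _ ⟨l, hl, rfl⟩
      exact Submodule.subset_span ⟨i :: l, by simpa using hl, by simp⟩
    exact hle hu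
  | zero => rw [zero_lie]; exact Submodule.zero_mem _
  | add a b _ _ ha hb => rw [add_lie]; exact Submodule.add_mem _ ha hb
  | smul t a _ ha => rw [smul_lie]; exact Submodule.smul_mem _ t ha

/-- As in the easy half of Poincaré–Birkhoff–Witt, exchanging adjacent factors costs a bracket,
which is a combination of the `x i` and so yields shorter monomials. -/
theorem prod_sub_prod_mem_monomialFiltration {ι : Type*} {x : ι → L}
    (hx : Submodule.span k (Set.range x) = ⊤) (v : V) {l l' : List ι} (h : l.Perm l') :
    (l.map fun i => toEnd k L V (x i)).prod v - (l'.map fun i => toEnd k L V (x i)).prod v ∈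
      monomialFiltration (k := k) x v l.length := by
  induction h with
  | nil => simp
  | cons i h ih =>
    simp only [List.map_cons, List.prod_cons, Module.End.mul_apply, List.length_cons,
      toEnd_apply_apply, ← lie_sub]
    exact lie_mem_monomialFiltration hx v ih (x i)
  | swap i j l =>
    simp only [List.map_cons, List.prod_cons, Module.End.mul_apply, List.length_cons,
      toEnd_apply_apply, ← lie_lie]
    exact lie_mem_monomialFiltration hx v (Submodule.subset_span ⟨l, l.length.lt_succ_self, rfl⟩) _
  | trans h₁ _ ih₁ ih₂ =>
    rw [← h₁.length_eq] at ih₂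
    have := Submodule.add_mem _ ih₁ ih₂
    rwa [sub_add_sub_cancel] at this

theorem monomialFiltration_le_orderedMonomials {d : ℕ} {x : Fin d → L}
    (hx : Submodule.span k (Set.range x) = ⊤) (v : V) (n : ℕ) :
    monomialFiltration (k := k) x v n ≤
      orderedMonomials v ((List.finRange d).map fun i => toEnd k L V (x i)) := by
  induction n with
  | zero => exact Submodule.span_le.2 fun u ⟨l, hl, _⟩ => absurd hl (Nat.not_lt_zero _)
  | succ n ih =>
    refine Submodule.span_le.2 ?_
    rintro _ ⟨l, hl, rfl⟩
    -- This is `l` sorted: equal indices are grouped, so its product is an ordered product of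
    -- powers, and the error is handled by induction on length.
    let l' := (List.finRange d).flatMap fun i => List.replicate (l.count i) i
    have hperm : l.Perm l' := by
      rw [List.perm_iff_count]
      intro i
      rw [List.count_flatMap]
      have : (List.count i ∘ fun i => List.replicate (l.count i) i) =
          fun j => if j = i then l.count i else 0 := by
        funext j
        by_cases hj : j = i
        · simp [hj]
        · simp [hj, List.count_replicate]
      rw [this, ← Fin.sum_univ_def, Finset.sum_ite_eq' Finset.univ i, if_pos (Finset.mem_univ i)]
    have h1 : (l'.map fun i => toEnd k L V (x i)).prod v ∈
        orderedMonomials v ((List.finRange d).map fun i => toEnd k L V (x i)) := by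
      have : (l'.map fun i => toEnd k L V (x i)).prod =
          ((List.finRange d).map fun i => toEnd k L V (x i) ^ l.count i).prod := by
        rw [List.map_flatMap, List.flatMap_def, List.prod_flatten, List.map_map]
        refine congrArg List.prod (List.map_congr_left fun i _ => ?_)
        simp
      rw [this]
      exact prod_pow_mem_orderedMonomials v _ _ _
    have h2 := prod_sub_prod_mem_monomialFiltration (k := k) hx v hperm
    have h3 : monomialFiltration (k := k) x v l.length ≤ monomialFiltration (k := k) x v n :=
      Submodule.span_mono fun u ⟨l₁, h, hu⟩ => ⟨l₁, by omega, hu⟩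
    have := Submodule.add_mem _ (ih (h3 h2)) h1
    rwa [sub_add_cancel] at this

/-- A module over a finite-dimensional Lie algebra spanned by elements acting locally nilpotently is
locally finite. -/
theorem exists_finiteDimensional_lieSubmodule [FiniteDimensional k L]
    (h : Submodule.span k {x : L | IsLocallyNilpotent (toEnd k L V x)} = ⊤) (v : V) :
    ∃ F : LieSubmodule k L V, FiniteDimensional k F ∧ v ∈ F := by
  obtain ⟨t, ht, -, hspan, -⟩ :=
    Submodule.exists_finset_span_eq_linearIndepOn k {x : L | IsLocallyNilpotent (toEnd k L V x)}
  rw [h] at hspan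
  let x : Fin t.card → L := fun i => (t.equivFin.symm i : L)
  have hx : Submodule.span k (Set.range x) = ⊤ := by
    rw [← hspan]
    congr 1
    ext y
    constructor
    · rintro ⟨i, rfl⟩
      exact (t.equivFin.symm i).2
    · intro hy
      exact ⟨t.equivFin ⟨y, hy⟩, by simp [x]⟩
  let F : Submodule k V := ⨆ n, monomialFiltration (k := k) x v n
  have hdir : Monotone fun n => monomialFiltration (k := k) x v n := fun m n hmn =>
    Submodule.span_mono fun u ⟨l, hl, hu⟩ => ⟨l, hl.trans_le hmn, hu⟩
  refine ⟨{ F with lie_mem := fun {y u} hu => ?_ }, ?_, ?_⟩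
  · change u ∈ F at hu
    change ⁅y, u⁆ ∈ F
    rw [Submodule.mem_iSup_of_directed _ hdir.directed_le] at hu ⊢
    obtain ⟨n, hn⟩ := hu
    exact ⟨n + 1, lie_mem_monomialFiltration hx v hn y⟩
  · have := finiteDimensional_orderedMonomials v
      ((List.finRange t.card).map fun i => toEnd k L V (x i)) (by
        intro D hD
        obtain ⟨i, -, rfl⟩ := List.mem_map.1 hD
        exact ht (t.equivFin.symm i).2)
    exact Submodule.finiteDimensional_of_le
      (iSup_le fun n => monomialFiltration_le_orderedMonomials hx v n : F ≤ _)
  · exact (le_iSup (fun n => monomialFiltration (k := k) x v n) 1)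
      (Submodule.subset_span ⟨[], by simp, by simp⟩)

/-- In a finite-dimensional module with trivial traces, ad-nilpotent elements act nilpotently. -/
theorem isLocallyNilpotent_toEnd_of_finiteDimensional [CharZero k] [IsAlgClosed k] [FiniteDimensional k V]
    {y : L} (hy : IsNilpotent (LieAlgebra.ad k L y))
    (htr : ∀ F : LieSubmodule k L V, LinearMap.trace k F (toEnd k L F y) = 0) :
    IsLocallyNilpotent (toEnd k L V y) := by
  -- Since ad y is nilpotent, each generalised eigenspace of `y` is an `L`-submodule. There the
  -- trace of `y` is `c` times the dimension, and it vanishes by hypothesis.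
  have h0 : ∀ c : k, c ≠ 0 → (toEnd k L V y).maxGenEigenspace c = ⊥ := by
    intro c hc
    let F : LieSubmodule k L V :=
      { (toEnd k L V y).maxGenEigenspace c with
        lie_mem := fun {z v} hv => by
          have hz : z ∈ (toEnd k L L y).maxGenEigenspace 0 := by
            obtain ⟨n, hn⟩ := hy
            rw [Module.End.mem_maxGenEigenspace]
            exact ⟨n, by
              have h1 : (toEnd k L L y) ^ n = 0 := hn
              rw [zero_smul, sub_zero, h1, LinearMap.zero_apply]⟩
          have := lie_mem_maxGenEigenspace_toEnd hz hv
          rwa [zero_add] at this }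
    have hnil : IsNilpotent (toEnd k L F y - c • (1 : Module.End k F)) := by
      exact Module.End.isNilpotent_restrict_maxGenEigenspace_sub_algebraMap (toEnd k L V y) c
    have h1 := (LinearMap.isNilpotent_trace_of_isNilpotent hnil).eq_zero
    rw [map_sub, htr, map_smul, LinearMap.trace_one, zero_sub, neg_eq_zero, smul_eq_mul,
      mul_eq_zero, or_iff_right hc, Nat.cast_eq_zero, Module.finrank_zero_iff] at h1
    have h2 : Subsingleton ((toEnd k L V y).maxGenEigenspace c) := h1
    exact (Submodule.subsingleton_iff_eq_bot).1 h2
  have htop : (toEnd k L V y).maxGenEigenspace 0 = ⊤ := by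
    rw [eq_top_iff, ← Module.End.iSup_maxGenEigenspace_eq_top (toEnd k L V y)]
    refine iSup_le fun c => ?_
    by_cases hc : c = 0
    · rw [hc]
    · rw [h0 c hc]; exact bot_le
  intro v
  have hv : v ∈ (toEnd k L V y).maxGenEigenspace 0 := by rw [htop]; trivial
  rw [Module.End.mem_maxGenEigenspace] at hv
  simpa using hv

theorem trace_toEnd_eq_zero_of_lie {x h : L} {c : k} (hc : c ≠ 0) (hx : ⁅h, x⁆ = c • x) :
    LinearMap.trace k V (toEnd k L V x) = 0 := by
  have h1 : LinearMap.trace k V (toEnd k L V ⁅h, x⁆) = 0 := by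
    rw [LieHom.map_lie, LinearMap.trace_lie]
  rw [hx, map_smul, map_smul, smul_eq_mul] at h1
  exact (mul_eq_zero.1 h1).resolve_left hc

/-- The powers of ad x that are nonzero are eigenvectors of the commutator with ad h, for the
distinct eigenvalues 2n; a finite-dimensional space has room for finitely many. -/
theorem isNilpotent_ad_of_lie [CharZero k] [FiniteDimensional k L] {x h : L} (hx : ⁅h, x⁆ = (2 : k) • x) :
    IsNilpotent (LieAlgebra.ad k L x) := by
  by_contra hnil
  set X := LieAlgebra.ad k L x
  set Y := LieAlgebra.ad k L h
  have hYX : Y * X - X * Y = (2 : k) • X := by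
    have : ⁅Y, X⁆ = (2 : k) • X := by
      rw [← LieHom.map_lie, hx, map_smul]
    rwa [LieRing.of_associative_ring_bracket] at this
  let D : Module.End k (Module.End k L) := LinearMap.mulLeft k Y - LinearMap.mulRight k Y
  have hD : ∀ n : ℕ, D (X ^ n) = (2 * n : k) • X ^ n := by
    intro n
    induction n with
    | zero => simp [D]
    | succ n ih =>
      have h1 : D (X ^ (n + 1)) = D (X ^ n) * X + X ^ n * (Y * X - X * Y) := by
        simp only [D, LinearMap.sub_apply, LinearMap.mulLeft_apply, LinearMap.mulRight_apply,
          pow_succ]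
        noncomm_ring
      rw [h1, ih, hYX, pow_succ, smul_mul_assoc, mul_smul_comm, ← add_smul]
      congr 1
      push_cast
      ring
  have hev : ∀ n : ℕ, D.HasEigenvalue (2 * n : k) := fun n =>
    Module.End.hasEigenvalue_of_hasEigenvector (x := X ^ n)
      ⟨Module.End.mem_eigenspace_iff.2 (hD n), fun h => hnil ⟨n, h⟩⟩
  refine (Set.infinite_range_of_injective (f := fun n : ℕ => (2 * n : k)) fun a b hab => ?_)
    ((Module.End.finite_hasEigenvalue D).subset ?_)
  · simpa using hab
  · rintro _ ⟨n, rfl⟩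
    exact hev n

end Integrable

/-! ### Ad-nilpotent elements on integrable modules. -/

section Basis

open LieModule

attribute [local instance 100] LieRing.ofAssociativeRing

variable {k 𝔤 V : Type*} [Field k] [CharZero k] [LieRing 𝔤] [LieAlgebra k 𝔤]
  [FiniteDimensional k 𝔤] [AddCommGroup V] [Module k V]
  {ι : Type*} [Finite ι] {H : LieSubalgebra k 𝔤} (b : LieAlgebra.Basis ι H)

theorem isNilpotent_ad_e (i : ι) : IsNilpotent (LieAlgebra.ad k 𝔤 (b.e i)) :=
  isNilpotent_ad_of_lie ((b.sl2 i).lie_h_e_smul k)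

theorem isNilpotent_ad_f (i : ι) : IsNilpotent (LieAlgebra.ad k 𝔤 (b.f i)) :=
  isNilpotent_ad_e b.symm i

/-- In an integrable module, all ad-nilpotent elements act locally nilpotently. -/
theorem isLocallyNilpotent_of_integrable [IsAlgClosed k] (ρ : 𝔤 →ₗ⁅k⁆ Module.End k V)
    (he : ∀ i, IsLocallyNilpotent (ρ (b.e i))) (hf : ∀ i, IsLocallyNilpotent (ρ (b.f i)))
    {y : 𝔤} (hy : IsNilpotent (LieAlgebra.ad k 𝔤 y)) : IsLocallyNilpotent (ρ y) := by
  let _ : LieRingModule 𝔤 V := LieRingModule.compLieHom V ρ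
  have _ : LieModule k 𝔤 V := LieModule.compLieHom V ρ
  have hρ : ∀ z, toEnd k 𝔤 V z = ρ z := fun z => rfl
  have hspan : Submodule.span k {x : 𝔤 | IsLocallyNilpotent (toEnd k 𝔤 V x)} = ⊤ := by
    refine span_isLocallyNilpotent_eq_top b.span_ef ?_ ?_
    · rintro _ (⟨i, rfl⟩ | ⟨i, rfl⟩)
      · exact isNilpotent_ad_e b i
      · exact isNilpotent_ad_f b i
    · rintro _ (⟨i, rfl⟩ | ⟨i, rfl⟩)
      · exact he i
      · exact hf i
  intro v
  -- On a finite-dimensional submodule the trace is zero on the generators `e i` and `f i`, which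
  -- are eigenvectors of ad (h i) of nonzero weight, hence on all of 𝔤. The trace criterion then
  -- applies.
  obtain ⟨F, hF, hv⟩ := exists_finiteDimensional_lieSubmodule hspan v
  have hnil : IsLocallyNilpotent (toEnd k 𝔤 F y) := by
    refine isLocallyNilpotent_toEnd_of_finiteDimensional hy fun F' => ?_
    refine LieAlgebra.trace_toEnd_eq_zero (s := Set.range b.e ∪ Set.range b.f) ?_
      (by rw [b.span_ef]; trivial)
    rintro _ (⟨i, rfl⟩ | ⟨i, rfl⟩)
    · exact trace_toEnd_eq_zero_of_lie two_ne_zero ((b.sl2 i).lie_h_e_smul k)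
    · exact trace_toEnd_eq_zero_of_lie two_ne_zero ((b.sl2 i).symm.lie_h_e_smul k)
  obtain ⟨n, hn⟩ := hnil ⟨v, hv⟩
  refine ⟨n, ?_⟩
  have hpow : ∀ (m : ℕ) (u : F), ((((toEnd k 𝔤 F y) ^ m) u : F) : V) = (ρ y ^ m) (u : V) := by
    intro m
    induction m with
    | zero => intro u; simp
    | succ m ih =>
      intro u
      rw [pow_succ, Module.End.mul_apply, ih, pow_succ, Module.End.mul_apply]
      rfl
  rw [← hpow n ⟨v, hv⟩, hn]
  rfl

end Basis

/-! ### Commutation formulas for sl₂ ⊗ A on a highest weight vector. -/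

section Current

variable {k A V : Type*} [Field k] [CommRing A] [AddCommGroup V] [Module k V]
  {E F K : A → Module.End k V}

theorem commutator_prod_mem_span (hKF : ∀ a c, K a * F c = F c * K a - (2 : k) • F (a * c)) (a : A)
    (l : List A) : K a * (l.map F).prod - (l.map F).prod * K a ∈
      Submodule.span k {D | ∃ l' : List A, l'.length = l.length ∧ D = (l'.map F).prod} := by
  induction l with
  | nil => simp
  | cons c l ih =>
    have h1 : K a * ((c :: l).map F).prod - ((c :: l).map F).prod * K a =
        F c * (K a * (l.map F).prod - (l.map F).prod * K a) -
          (2 : k) • (((a * c) :: l).map F).prod := by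
      simp only [List.map_cons, List.prod_cons]
      rw [← mul_assoc, hKF, sub_mul, smul_mul_assoc]
      noncomm_ring
    rw [h1]
    refine Submodule.sub_mem _ ?_ (Submodule.smul_mem _ _ (Submodule.subset_span ⟨_, by simp, rfl⟩))
    have hle : Submodule.span k {D | ∃ l' : List A, l'.length = l.length ∧ D = (l'.map F).prod} ≤
        (Submodule.span k {D | ∃ l' : List A, l'.length = (c :: l).length ∧
          D = (l'.map F).prod}).comap (LinearMap.mulLeft k (F c)) := by
      refine Submodule.span_le.2 ?_
      rintro _ ⟨l', hl', rfl⟩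
      exact Submodule.subset_span ⟨c :: l', by simp [hl'], by simp⟩
    exact hle ih

theorem prod_map_mul_comm {A : Type*} {F : A → Module.End k V} (hFF : ∀ a c, F a * F c = F c * F a) (a : A) (l : List A) :
    F a * (l.map F).prod = (l.map F).prod * F a := by
  induction l with
  | nil => simp
  | cons c l ih =>
    rw [List.map_cons, List.prod_cons, ← mul_assoc, hFF, mul_assoc, ih, mul_assoc]

/-- If `w` is a weight vector killed by `F 1 ^ N`, it is killed by all monomials of degree `N`. -/
theorem prod_apply_eq_zero [CharZero k] (hFF : ∀ a c, F a * F c = F c * F a)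
    (hKF : ∀ a c, K a * F c = F c * K a - (2 : k) • F (a * c)) {w : V}
    (hK : ∀ a, ∃ c : k, K a w = c • w) {N : ℕ} (hN : (F 1 ^ N) w = 0) (l : List A) (r : ℕ)
    (hl : l.length + r = N) : (l.map F).prod ((F 1 ^ r) w) = 0 := by
  obtain ⟨p, hp⟩ : ∃ p, l.length = p := ⟨_, rfl⟩
  induction p generalizing l r with
  | zero =>
    rw [List.length_eq_zero_iff] at hp
    subst hp
    simp only [List.length_nil, zero_add] at hl
    simp [hl, hN]
  | succ p ih =>
    obtain ⟨a, l, rfl⟩ := List.exists_of_length_succ l hp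
    simp only [List.length_cons, Nat.add_right_cancel_iff] at hp hl
    have hpow : ∀ n : ℕ, K a * F 1 ^ (n + 1) =
        F 1 ^ (n + 1) * K a - (2 * (n + 1) : k) • (F a * F 1 ^ n) := by
      intro n
      induction n with
      | zero => simp [hKF]
      | succ n ihn =>
        rw [pow_succ, ← mul_assoc, ihn, sub_mul, mul_assoc _ (K a), hKF, mul_sub, mul_one,
          mul_smul_comm, smul_mul_assoc, mul_assoc (F a), ← pow_succ, ← mul_assoc,
          ← (Commute.pow_right (hFF a 1) (n + 1)).eq, sub_sub, ← add_smul]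
        congr 2
        push_cast
        ring
    have h0 : ∀ l' : List A, l'.length = l.length → (l'.map F).prod ((F 1 ^ (r + 1)) w) = 0 :=
      fun l' hl' => ih l' (r + 1) (by omega) (by omega)
    -- Commuting `K a` through the monomial gives monomials of the same length, which kill `F 1 ^ (r
    -- + 1) w` by induction. What is left is `K a` acting on `F 1 ^ (r + 1) w`, which trades one `F
    -- 1` for `F a` with coefficient -2(r + 1).
    have h1 : (K a * (l.map F).prod - (l.map F).prod * K a) ((F 1 ^ (r + 1)) w) = 0 := by
      have hle : Submodule.span k {D | ∃ l' : List A, l'.length = l.length ∧ D = (l'.map F).prod} ≤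
          LinearMap.ker (LinearMap.applyₗ ((F 1 ^ (r + 1)) w) : Module.End k V →ₗ[k] V) := by
        refine Submodule.span_le.2 ?_
        rintro _ ⟨l', hl', rfl⟩
        exact h0 l' hl'
      exact hle (commutator_prod_mem_span hKF a l)
    obtain ⟨c, hc⟩ := hK a
    rw [LinearMap.sub_apply, Module.End.mul_apply, h0 l rfl, map_zero, zero_sub, neg_eq_zero,
      Module.End.mul_apply, ← Module.End.mul_apply (K a), hpow, LinearMap.sub_apply,
      Module.End.mul_apply, hc, map_smul, map_sub, map_smul, h0 l rfl, smul_zero, zero_sub,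
      neg_eq_zero, LinearMap.smul_apply, map_smul, smul_eq_zero, Module.End.mul_apply,
      ← Module.End.mul_apply _ (F a), ← prod_map_mul_comm hFF] at h1
    refine h1.resolve_left (mul_ne_zero two_ne_zero ?_)
    exact_mod_cast r.succ_ne_zero

/-- Each factor passed by `K a` absorbs `a` and contributes -2. The operator `T` stands for what is
applied afterwards, assumed to see only the length and the product of the arguments, so all
contributions are equal. -/
theorem apply_K_prod (hKF : ∀ a c, K a * F c = F c * K a - (2 : k) • F (a * c)) {w : V} {a : A}
    (hK : K a w = 0) (X : V) (l : List A) (T : Module.End k V)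
    (hT : ∀ l' : List A, l'.length = l.length → l'.prod = a * l.prod → T ((l'.map F).prod w) = X) :
    T (K a ((l.map F).prod w)) = (-2 * l.length : k) • X := by
  induction l generalizing T with
  | nil => simp [hK]
  | cons c l ih =>
    have h1 := ih (T * F c) fun l' h1 h2 => by
      rw [Module.End.mul_apply, ← Module.End.mul_apply (F c), ← List.prod_cons, ← List.map_cons]
      exact hT (c :: l') (by simp [h1]) (by rw [List.prod_cons, List.prod_cons, h2]; ring)
    have h2 := hT ((a * c) :: l) (by simp) (by simp [mul_assoc])
    rw [List.map_cons, List.prod_cons, Module.End.mul_apply] at h2 ⊢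
    rw [← Module.End.mul_apply (K a), hKF, LinearMap.sub_apply, map_sub, LinearMap.smul_apply,
      map_smul, h2, Module.End.mul_apply, ← Module.End.mul_apply T, h1, ← sub_smul]
    congr 1
    push_cast [List.length_cons]
    ring

/-- Each factor passed by `E a` turns into some `K (a * c)`, which then passes the factors to its
right; summing their numbers gives the binomial coefficient. -/
theorem apply_E_prod (hKF : ∀ a c, K a * F c = F c * K a - (2 : k) • F (a * c))
    (hEF : ∀ a c, E a * F c = F c * E a + K (a * c)) {w : V} {a : A}
    (hK : ∀ c, K (a * c) w = 0) (hE : E a w = 0) (X : V) (l : List A) (T : Module.End k V)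
    (hT : ∀ l' : List A, l'.length + 1 = l.length → l'.prod = a * l.prod →
      T ((l'.map F).prod w) = X) :
    T (E a ((l.map F).prod w)) = (-2 * l.length.choose 2 : k) • X := by
  induction l generalizing T with
  | nil => simp [hE]
  | cons c l ih =>
    have h1 := ih (T * F c) fun l' h1 h2 => by
      rw [Module.End.mul_apply, ← Module.End.mul_apply (F c), ← List.prod_cons, ← List.map_cons]
      exact hT (c :: l') (by simp [h1]) (by rw [List.prod_cons, List.prod_cons, h2]; ring)
    have h2 := apply_K_prod hKF (hK c) X l T fun l' h1 h2 =>
      hT l' (by simp [h1]) (by rw [h2, List.prod_cons, mul_assoc])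
    rw [List.map_cons, List.prod_cons, Module.End.mul_apply, ← Module.End.mul_apply (E a), hEF,
      LinearMap.add_apply, map_add, h2, Module.End.mul_apply, ← Module.End.mul_apply T, h1,
      ← add_smul]
    congr 1
    rw [List.length_cons, Nat.choose_succ_succ' l.length 1, Nat.choose_one_right]
    push_cast
    ring

/-- Each `E a` shortens the monomial by one factor and multiplies the product of its arguments by
`a`, so `r` of them reduce `r + 1` factors to a single `F`. The constant is a product of numbers -2
· choose(j, 2) with `j ≥ 2`, hence nonzero. -/
theorem exists_prod_E_prod_F [CharZero k]
    (hKF : ∀ a c, K a * F c = F c * K a - (2 : k) • F (a * c))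
    (hEF : ∀ a c, E a * F c = F c * E a + K (a * c)) {w : V} (I : Ideal A)
    (hK : ∀ a ∈ I, K a w = 0) (hE : ∀ a, E a w = 0) (r : ℕ) :
    ∃ c : k, c ≠ 0 ∧ ∀ m : List A, m.length = r → (∀ a ∈ m, a ∈ I) → ∀ l : List A,
      l.length = r + 1 → (m.map E).prod ((l.map F).prod w) = c • F (m.prod * l.prod) w := by
  induction r with
  | zero =>
    refine ⟨1, one_ne_zero, fun m hm _ l hl => ?_⟩
    rw [List.length_eq_zero_iff] at hm
    obtain ⟨a, rfl⟩ := List.length_eq_one_iff.1 hl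
    simp [hm]
  | succ r ih =>
    obtain ⟨c, hc, h⟩ := ih
    refine ⟨-2 * (r + 2).choose 2 * c, mul_ne_zero (mul_ne_zero (by simp) ?_) hc,
      fun m hm hI l hl => ?_⟩
    · exact_mod_cast (Nat.choose_pos (by omega)).ne'
    · obtain rfl | ⟨m, a, rfl⟩ := List.eq_nil_or_concat' m
      · simp at hm
      · have ha : a ∈ I := hI a (by simp)
        rw [List.map_append, List.prod_append, List.map_singleton, List.prod_singleton,
          Module.End.mul_apply, apply_E_prod hKF hEF (fun c => hK _ (I.mul_mem_right c ha)) (hE a)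
            (c • F ((m ++ [a]).prod * l.prod) w) l _ fun l' h1 h2 => ?_, hl, smul_smul]
        rw [h m (by simpa using hm) (fun a' ha' => hI a' (by simp [ha'])) l' (by omega), h2,
          List.prod_append, List.prod_singleton, mul_assoc]

/-- If `w` is a highest weight vector of weight vanishing on the ideal `I`, and `F 1 ^ (r + 1)`
kills `w`, then `F a` kills `w` for all `a ∈ I ^ r`. -/
theorem apply_eq_zero_of_mem_pow [CharZero k] (hF : ∀ a c, F (a + c) = F a + F c)
    (hFF : ∀ a c, F a * F c = F c * F a)
    (hKF : ∀ a c, K a * F c = F c * K a - (2 : k) • F (a * c))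
    (hEF : ∀ a c, E a * F c = F c * E a + K (a * c)) {w : V} (I : Ideal A)
    (hKw : ∀ a, ∃ c : k, K a w = c • w)
    (hK : ∀ a ∈ I, K a w = 0) (hE : ∀ a, E a w = 0) {r : ℕ} (hr : (F 1 ^ (r + 1)) w = 0)
    {a : A} (ha : a ∈ I ^ r) : F a w = 0 := by
  have hF0 : F 0 = 0 := by simpa using hF 0 0
  rw [Submodule.pow_eq_span_pow_set] at ha
  -- The extra factor `d` lets the span induction pass through multiplication by elements of `A`.
  -- For a product of `r` elements of `I`, the formula above is applied to `F d * F 1 ^ r`, which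
  -- kills `w`.
  suffices h : ∀ d, F (d * a) w = 0 by simpa using h 1
  induction ha using Submodule.span_induction with
  | mem a ha =>
    intro d
    obtain ⟨f, rfl⟩ := Set.mem_pow.1 ha
    obtain ⟨c, hc, h⟩ := exists_prod_E_prod_F hKF hEF I hK hE r
    have h1 := h (List.ofFn fun i => (f i : A)) (by simp)
      (fun a ha => by obtain ⟨i, rfl⟩ := (List.mem_ofFn' _ _).1 ha; exact (f i).2)
      (d :: List.replicate r 1) (by simp)
    rw [List.map_cons, List.map_replicate, List.prod_cons, List.prod_replicate,
      Module.End.mul_apply] at h1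
    have h2 := prod_apply_eq_zero hFF hKF hKw hr [d] r (by simp [add_comm])
    rw [List.map_singleton, List.prod_singleton] at h2
    rw [h2, map_zero, eq_comm, smul_eq_zero, or_iff_right hc] at h1
    simpa [mul_comm] using h1
  | zero => intro d; rw [mul_zero, hF0, LinearMap.zero_apply]
  | add x y _ _ hx hy => intro d; rw [mul_add, hF, LinearMap.add_apply, hx, hy, add_zero]
  | smul c x _ hx => intro d; rw [smul_eq_mul, ← mul_assoc]; exact hx _

end Current

/-! ### Local Weyl modules: universal property, integrability, annihilator. -/

section WeylModule

attribute [local instance 100] LieRing.ofAssociativeRing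

variable {k 𝔤 : Type*} [Field k] [LieRing 𝔤] [LieAlgebra k 𝔤]
  {ι : Type*} [Finite ι] {H : LieSubalgebra k 𝔤} {b : LieAlgebra.Basis ι H}
  {A : Type*} [CommRing A] [Algebra k A]

/-- By the universal property, the identity factors through the subalgebra generated by the image of
`L`. -/
theorem adjoin_range_ι (L : Type*) [LieRing L] [LieAlgebra k L] :
    Algebra.adjoin k (Set.range (UniversalEnvelopingAlgebra.ι k : L → _)) = ⊤ := by
  set S := Algebra.adjoin k (Set.range (UniversalEnvelopingAlgebra.ι k : L → _)) with hS
  let f : L →ₗ⁅k⁆ S :=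
    { toFun := fun x => ⟨UniversalEnvelopingAlgebra.ι k x, Algebra.subset_adjoin ⟨x, rfl⟩⟩
      map_add' := fun x y => Subtype.ext (map_add _ x y)
      map_smul' := fun c x => Subtype.ext (map_smul _ c x)
      map_lie' := fun {x y} => Subtype.ext
        ((LieHom.map_lie _ x y).trans (LieRing.of_associative_ring_bracket _ _)) }
  have h : S.val.comp (UniversalEnvelopingAlgebra.lift k f) = AlgHom.id k _ := by
    apply UniversalEnvelopingAlgebra.hom_ext
    ext x
    simp [f]
  refine eq_top_iff.2 fun u _ => ?_
  have := DFunLike.congr_fun h u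
  rw [AlgHom.id_apply] at this
  rw [← this]
  exact (UniversalEnvelopingAlgebra.lift k f u).2

/-- The cyclic vector of the local Weyl module. -/
def weylGen (ψ : WeightFun b A) : WeylModule ψ :=
  (Submodule.Quotient.mk 1 : UniversalEnvelopingAlgebra k (A ⊗[k] 𝔤) ⧸
    Submodule.span (UniversalEnvelopingAlgebra k (A ⊗[k] 𝔤)) (weylRelations ψ))

variable (ψ : WeightFun b A)

theorem exists_smul_weylGen (v : WeylModule ψ) :
    ∃ u : UniversalEnvelopingAlgebra k (A ⊗[k] 𝔤), u • weylGen ψ = v := by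
  obtain ⟨u, rfl⟩ := Submodule.Quotient.mk_surjective _ v
  refine ⟨u, ?_⟩
  change Submodule.Quotient.mk (u • 1) = _
  rw [smul_eq_mul, mul_one]

theorem smul_weylGen_eq_zero {u : UniversalEnvelopingAlgebra k (A ⊗[k] 𝔤)}
    (hu : u ∈ weylRelations ψ) : u • weylGen ψ = 0 := by
  change Submodule.Quotient.mk (u • 1) = _
  rw [smul_eq_mul, mul_one]
  exact (Submodule.Quotient.mk_eq_zero _).2 (Submodule.subset_span hu)

theorem ι_pow_smul (α : A ⊗[k] 𝔤) (n : ℕ) (v : WeylModule ψ) :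
    UniversalEnvelopingAlgebra.ι k α ^ n • v =
      (LieModule.toEnd k (A ⊗[k] 𝔤) (WeylModule ψ) α ^ n) v := by
  induction n with
  | zero => simp
  | succ n ih => rw [pow_succ', mul_smul, ih, pow_succ', Module.End.mul_apply]; rfl

theorem eq_top_of_weylGen_mem (p : Submodule k (WeylModule ψ)) (hp : weylGen ψ ∈ p)
    (h : ∀ (α : A ⊗[k] 𝔤), ∀ v ∈ p, ⁅α, v⁆ ∈ p) : p = ⊤ := by
  have key : ∀ (u : UniversalEnvelopingAlgebra k (A ⊗[k] 𝔤)), ∀ v ∈ p, u • v ∈ p := by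
    intro u
    have hu : u ∈ Algebra.adjoin k
        (Set.range (UniversalEnvelopingAlgebra.ι k : A ⊗[k] 𝔤 → _)) := by
      rw [adjoin_range_ι]; trivial
    induction hu using Algebra.adjoin_induction with
    | mem u hu => obtain ⟨α, rfl⟩ := hu; exact h α
    | algebraMap c => intro v hv; rw [algebraMap_smul]; exact p.smul_mem c hv
    | add x y _ _ hx hy => intro v hv; rw [add_smul]; exact p.add_mem (hx v hv) (hy v hv)
    | mul x y _ _ hx hy => intro v hv; rw [mul_smul]; exact hx _ (hy v hv)
  refine eq_top_iff.2 fun v _ => ?_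
  obtain ⟨u, rfl⟩ := exists_smul_weylGen ψ v
  exact key u _ hp

theorem lie_weylGen_of_mem_borelUpper (a : A) {y : 𝔤} (hy : y ∈ b.borelUpper) :
    ⁅a ⊗ₜ[k] y, weylGen ψ⁆ = 0 :=
  smul_weylGen_eq_zero ψ (Or.inl (Or.inl ⟨a, y, hy, rfl⟩))

theorem lie_weylGen_of_mem_cartan (a : A) (h : H) :
    ⁅a ⊗ₜ[k] (h : 𝔤), weylGen ψ⁆ =
      (ψ.sum fun x μ => x a * (μ : Module.Dual k H) h) • weylGen ψ := by
  have h1 := smul_weylGen_eq_zero ψ (Or.inr ⟨a, h, rfl⟩)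
  rw [sub_smul, algebraMap_smul, sub_eq_zero] at h1
  exact h1

theorem toEnd_f_pow_weylGen {i : ι} {n : ℕ} (hn : (wt ψ : Module.Dual k H) (b.h' i) = n) :
    (LieModule.toEnd k (A ⊗[k] 𝔤) (WeylModule ψ) (1 ⊗ₜ[k] b.f i) ^ (n + 1)) (weylGen ψ) = 0 := by
  rw [← ι_pow_smul]
  exact smul_weylGen_eq_zero ψ (Or.inl (Or.inr ⟨i, n, hn, rfl⟩))

/-- The universal property of the local Weyl module. -/
theorem exists_linearMap_weylModule {N : Type*} [AddCommGroup N] [Module k N]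
    (ρ : A ⊗[k] 𝔤 →ₗ⁅k⁆ Module.End k N) (n : N)
    (hE : ∀ (a : A), ∀ y ∈ b.borelUpper, ρ (a ⊗ₜ[k] y) n = 0)
    (hF : ∀ (i : ι) (m : ℕ), (wt ψ : Module.Dual k H) (b.h' i) = m →
      (ρ (1 ⊗ₜ[k] b.f i) ^ (m + 1)) n = 0)
    (hH : ∀ (a : A) (h : H), ρ (a ⊗ₜ[k] (h : 𝔤)) n =
      (ψ.sum fun x μ => x a * (μ : Module.Dual k H) h) • n) :
    ∃ φ : WeylModule ψ →ₗ[k] N, φ (weylGen ψ) = n ∧ ∀ α v, φ ⁅α, v⁆ = ρ α (φ v) := by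
  let Φ := UniversalEnvelopingAlgebra.lift k ρ
  let _ : Module (UniversalEnvelopingAlgebra k (A ⊗[k] 𝔤)) N := Module.compHom N Φ.toRingHom
  have hsmul : ∀ (u : UniversalEnvelopingAlgebra k (A ⊗[k] 𝔤)) (m : N), u • m = Φ u m :=
    fun u m => rfl
  let φ : WeylModule ψ →ₗ[UniversalEnvelopingAlgebra k (A ⊗[k] 𝔤)] N :=
    Submodule.liftQ _ (LinearMap.toSpanSingleton _ N n) (by
      refine Submodule.span_le.2 ?_
      rintro _ ((⟨a, y, hy, rfl⟩ | ⟨i, m, hm, rfl⟩) | ⟨a, h, rfl⟩)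
      · rw [SetLike.mem_coe, LinearMap.mem_ker, LinearMap.toSpanSingleton_apply, hsmul,
          UniversalEnvelopingAlgebra.lift_ι_apply, hE a y hy]
      · rw [SetLike.mem_coe, LinearMap.mem_ker, LinearMap.toSpanSingleton_apply, hsmul,
          map_pow, UniversalEnvelopingAlgebra.lift_ι_apply, hF i m hm]
      · rw [SetLike.mem_coe, LinearMap.mem_ker, LinearMap.toSpanSingleton_apply, hsmul,
          map_sub, UniversalEnvelopingAlgebra.lift_ι_apply, LinearMap.sub_apply, hH,
          AlgHom.commutes, Module.algebraMap_end_apply, sub_self])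
  refine ⟨{ toFun := φ, map_add' := φ.map_add, map_smul' := fun c v => ?_ }, ?_, fun α v => ?_⟩
  · rw [← algebraMap_smul (UniversalEnvelopingAlgebra k (A ⊗[k] 𝔤)) c v, map_smul, hsmul,
      AlgHom.commutes, Module.algebraMap_end_apply, RingHom.id_apply]
  · change (1 : UniversalEnvelopingAlgebra k (A ⊗[k] 𝔤)) • n = n
    rw [one_smul]
  · change φ (UniversalEnvelopingAlgebra.ι k α • v) = ρ α (φ v)
    rw [map_smul, hsmul, UniversalEnvelopingAlgebra.lift_ι_apply]

/-- The action of `A ⊗ 𝔤` on the local Weyl module. -/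
abbrev weylAct : A ⊗[k] 𝔤 →ₗ⁅k⁆ Module.End k (WeylModule ψ) :=
  LieModule.toEnd k (A ⊗[k] 𝔤) (WeylModule ψ)

theorem toEnd_mul {L V : Type*} [LieRing L] [LieAlgebra k L] [AddCommGroup V] [Module k V]
    (ρ : L →ₗ⁅k⁆ Module.End k V) (x y : L) : ρ x * ρ y = ρ y * ρ x + ρ ⁅x, y⁆ := by
  rw [LieHom.map_lie, LieRing.of_associative_ring_bracket]
  abel

theorem weylAct_K_mul_F (i : ι) (a c : A) :
    weylAct ψ (a ⊗ₜ[k] b.h i) * weylAct ψ (c ⊗ₜ[k] b.f i) =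
      weylAct ψ (c ⊗ₜ[k] b.f i) * weylAct ψ (a ⊗ₜ[k] b.h i) -
        (2 : k) • weylAct ψ ((a * c) ⊗ₜ[k] b.f i) := by
  rw [toEnd_mul, LieAlgebra.ExtendScalars.bracket_tmul, (b.sl2 i).lie_lie_smul_f k,
    TensorProduct.tmul_neg, TensorProduct.tmul_smul, map_neg, map_smul, sub_eq_add_neg]

theorem weylAct_E_mul_F (i : ι) (a c : A) :
    weylAct ψ (a ⊗ₜ[k] b.e i) * weylAct ψ (c ⊗ₜ[k] b.f i) =
      weylAct ψ (c ⊗ₜ[k] b.f i) * weylAct ψ (a ⊗ₜ[k] b.e i) +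
        weylAct ψ ((a * c) ⊗ₜ[k] b.h i) := by
  rw [toEnd_mul, LieAlgebra.ExtendScalars.bracket_tmul, (b.sl2 i).lie_e_f]

theorem weylAct_F_mul_F (i : ι) (a c : A) :
    weylAct ψ (a ⊗ₜ[k] b.f i) * weylAct ψ (c ⊗ₜ[k] b.f i) =
      weylAct ψ (c ⊗ₜ[k] b.f i) * weylAct ψ (a ⊗ₜ[k] b.f i) := by
  rw [toEnd_mul, LieAlgebra.ExtendScalars.bracket_tmul, lie_self, TensorProduct.tmul_zero, map_zero,
    add_zero]

theorem weylAct_K_weylGen (i : ι) (a : A) :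
    weylAct ψ (a ⊗ₜ[k] b.h i) (weylGen ψ) =
      (ψ.sum fun x μ => x a * (μ : Module.Dual k H) (b.h' i)) • weylGen ψ :=
  lie_weylGen_of_mem_cartan ψ a (b.h' i)

theorem e_mem_borelUpper (i : ι) : b.e i ∈ b.borelUpper :=
  LieSubalgebra.subset_lieSpan ⟨i, rfl⟩

theorem ad_tmul_pow (a c : A) (y z : 𝔤) (n : ℕ) :
    (LieAlgebra.ad k (A ⊗[k] 𝔤) (a ⊗ₜ[k] y) ^ n) (c ⊗ₜ[k] z) =
      (a ^ n * c) ⊗ₜ[k] (LieAlgebra.ad k 𝔤 y ^ n) z := by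
  induction n with
  | zero => simp
  | succ n ih =>
    rw [pow_succ', Module.End.mul_apply, ih, LieAlgebra.ad_apply,
      LieAlgebra.ExtendScalars.bracket_tmul, pow_succ' _ n, pow_succ' _ n, Module.End.mul_apply,
      LieAlgebra.ad_apply, mul_assoc]

theorem isNilpotent_ad_tmul (a : A) {y : 𝔤} (hy : IsNilpotent (LieAlgebra.ad k 𝔤 y)) :
    IsNilpotent (LieAlgebra.ad k (A ⊗[k] 𝔤) (a ⊗ₜ[k] y)) := by
  obtain ⟨n, hn⟩ := hy
  refine ⟨n, ?_⟩
  ext c z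
  simp [ad_tmul_pow, hn]

/-- When ad α is locally nilpotent, the generalised 0-eigenspace of α is a submodule, so it is
everything as soon as it contains the generator. -/
theorem isLocallyNilpotent_weylAct {α : A ⊗[k] 𝔤}
    (hα : IsLocallyNilpotent (LieAlgebra.ad k (A ⊗[k] 𝔤) α)) {n : ℕ}
    (hn : (weylAct ψ α ^ n) (weylGen ψ) = 0) : IsLocallyNilpotent (weylAct ψ α) := by
  have htop : (weylAct ψ α).maxGenEigenspace 0 = ⊤ := by
    refine eq_top_of_weylGen_mem ψ _ ?_ fun β v hv => ?_
    · rw [Module.End.mem_maxGenEigenspace]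
      exact ⟨n, by rwa [zero_smul, sub_zero]⟩
    · have hβ : β ∈ (LieModule.toEnd k (A ⊗[k] 𝔤) (A ⊗[k] 𝔤) α).maxGenEigenspace 0 := by
        rw [Module.End.mem_maxGenEigenspace]
        obtain ⟨m, hm⟩ := hα β
        exact ⟨m, by rw [zero_smul, sub_zero]; exact hm⟩
      simpa using LieModule.lie_mem_maxGenEigenspace_toEnd hβ hv
  intro v
  have hv : v ∈ (weylAct ψ α).maxGenEigenspace 0 := by rw [htop]; trivial
  rw [Module.End.mem_maxGenEigenspace] at hv
  simpa using hv

/-- The functions vanishing on the support. -/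
def supportIdeal : Ideal A := ⨅ x ∈ ψ.support, RingHom.ker x

theorem mem_supportIdeal {a : A} : a ∈ supportIdeal ψ ↔ ∀ x ∈ ψ.support, x a = 0 := by
  simp [supportIdeal, RingHom.mem_ker]

variable [CharZero k] [FiniteDimensional k 𝔤]

theorem isLocallyNilpotent_weylAct_e (a : A) (i : ι) :
    IsLocallyNilpotent (weylAct ψ (a ⊗ₜ[k] b.e i)) :=
  isLocallyNilpotent_weylAct ψ (.of_isNilpotent (isNilpotent_ad_tmul a (isNilpotent_ad_e b i)))
    (n := 1) (by rw [pow_one]; exact lie_weylGen_of_mem_borelUpper ψ a (e_mem_borelUpper i))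

theorem isLocallyNilpotent_weylAct_f (a : A) (i : ι) :
    IsLocallyNilpotent (weylAct ψ (a ⊗ₜ[k] b.f i)) := by
  obtain ⟨n, hn⟩ := (wt ψ).2 i
  refine isLocallyNilpotent_weylAct ψ
    (.of_isNilpotent (isNilpotent_ad_tmul a (isNilpotent_ad_f b i))) (n := n + 1) ?_
  have := prod_apply_eq_zero (F := fun a => weylAct ψ (a ⊗ₜ[k] b.f i))
    (K := fun a => weylAct ψ (a ⊗ₜ[k] b.h i)) (weylAct_F_mul_F ψ i) (weylAct_K_mul_F ψ i)
    (fun a => ⟨_, weylAct_K_weylGen ψ i a⟩) (toEnd_f_pow_weylGen ψ hn)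
    (List.replicate (n + 1) a) 0 (by simp)
  simpa using this

/-- A power of the ideal of functions vanishing on the support annihilates the local Weyl module. -/
theorem exists_pow_supportIdeal_annihilates :
    ∃ M : ℕ, ∀ N ≥ M, ∀ a ∈ supportIdeal ψ ^ N, ∀ y : 𝔤, weylAct ψ (a ⊗ₜ[k] y) = 0 := by
  have hsum : ∀ a ∈ supportIdeal ψ, ∀ h : H,
      (ψ.sum fun x μ => x a * (μ : Module.Dual k H) h) = 0 := fun a ha h =>
    Finset.sum_eq_zero fun x hx => by beta_reduce; rw [(mem_supportIdeal ψ).1 ha x hx, zero_mul]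
  have hgen : ∀ y : 𝔤, ∃ M : ℕ, ∀ a ∈ supportIdeal ψ ^ M, ⁅a ⊗ₜ[k] y, weylGen ψ⁆ = 0 := by
    intro y
    have hy : y ∈ LieSubalgebra.lieSpan k 𝔤 (Set.range b.e ∪ Set.range b.f) := by
      rw [b.span_ef]; trivial
    induction hy using LieSubalgebra.lieSpan_induction with
    | mem y hy =>
      obtain ⟨i, rfl⟩ | ⟨i, rfl⟩ := hy
      · exact ⟨0, fun a _ => lie_weylGen_of_mem_borelUpper ψ a (e_mem_borelUpper i)⟩
      · obtain ⟨n, hn⟩ := (wt ψ).2 i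
        refine ⟨n, fun a ha => ?_⟩
        refine apply_eq_zero_of_mem_pow (E := fun a => weylAct ψ (a ⊗ₜ[k] b.e i))
          (F := fun a => weylAct ψ (a ⊗ₜ[k] b.f i)) (K := fun a => weylAct ψ (a ⊗ₜ[k] b.h i))
          (fun a c => by rw [TensorProduct.add_tmul, map_add]) (weylAct_F_mul_F ψ i)
          (weylAct_K_mul_F ψ i) (weylAct_E_mul_F ψ i) (supportIdeal ψ)
          (fun a => ⟨_, weylAct_K_weylGen ψ i a⟩) (fun a ha => ?_)
          (fun a => lie_weylGen_of_mem_borelUpper ψ a (e_mem_borelUpper i))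
          (toEnd_f_pow_weylGen ψ hn) ha
        rw [weylAct_K_weylGen, hsum a ha, zero_smul]
    | zero => exact ⟨0, fun a _ => by rw [TensorProduct.tmul_zero, zero_lie]⟩
    | add y z _ _ hy hz =>
      obtain ⟨m, hm⟩ := hy
      obtain ⟨n, hn⟩ := hz
      refine ⟨max m n, fun a ha => ?_⟩
      rw [TensorProduct.tmul_add, add_lie, hm a (Ideal.pow_le_pow_right (le_max_left m n) ha),
        hn a (Ideal.pow_le_pow_right (le_max_right m n) ha), add_zero]
    | smul c y _ hy =>
      obtain ⟨m, hm⟩ := hy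
      exact ⟨m, fun a ha => by rw [TensorProduct.tmul_smul, smul_lie, hm a ha, smul_zero]⟩
    | lie y z _ _ hy hz =>
      obtain ⟨m, hm⟩ := hy
      obtain ⟨n, hn⟩ := hz
      -- A product a c with `a` in the `m`-th and `c` in the `n`-th power gives (a c) ⊗ ⁅y, z⁆ = ⁅a
      -- ⊗ y, c ⊗ z⁆, and both entries kill the generator.
      refine ⟨m + n, fun a ha => ?_⟩
      rw [pow_add] at ha
      induction ha using Submodule.mul_induction_on' with
      | mem_mul_mem a ha c hc =>
        rw [← LieAlgebra.ExtendScalars.bracket_tmul, lie_lie, hn c hc, hm a ha, lie_zero, lie_zero,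
          sub_zero]
      | add a _ c _ ha hc => rw [TensorProduct.add_tmul, add_lie, ha, hc, add_zero]
  obtain ⟨t, ht⟩ := (inferInstance : Module.Finite k 𝔤)
  choose m hm using hgen
  refine ⟨t.sup m, fun N hN => ?_⟩
  have hgen : ∀ y : 𝔤, ∀ a ∈ supportIdeal ψ ^ N, ⁅a ⊗ₜ[k] y, weylGen ψ⁆ = 0 := by
    intro y a ha
    have hy : y ∈ Submodule.span k (t : Set 𝔤) := by rw [ht]; trivial
    induction hy using Submodule.span_induction with
    | mem y hy => exact hm y a (Ideal.pow_le_pow_right ((Finset.le_sup hy).trans hN) ha)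
    | zero => rw [TensorProduct.tmul_zero, zero_lie]
    | add y z _ _ hy hz => rw [TensorProduct.tmul_add, add_lie, hy, hz, add_zero]
    | smul c y _ hy => rw [TensorProduct.tmul_smul, smul_lie, hy, smul_zero]
  let p : Submodule k (WeylModule ψ) :=
    ⨅ a : (supportIdeal ψ ^ N : Ideal A), ⨅ y : 𝔤, LinearMap.ker (weylAct ψ ((a : A) ⊗ₜ[k] y))
  have hp : ∀ v, v ∈ p ↔ ∀ a ∈ supportIdeal ψ ^ N, ∀ y : 𝔤, ⁅a ⊗ₜ[k] y, v⁆ = 0 := by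
    intro v
    simp [p, Submodule.mem_iInf]
  -- The tensors with coefficient in the ideal power span a Lie ideal of `A ⊗ 𝔤`, so the vectors
  -- they kill form a submodule; it contains the generator.
  have htop : p = ⊤ := by
    refine eq_top_of_weylGen_mem ψ p ((hp _).2 fun a ha y => hgen y a ha) fun β v hv =>
      (hp _).2 fun a ha y => ?_
    rw [hp] at hv
    induction β using TensorProduct.induction_on with
    | zero => rw [zero_lie, lie_zero]
    | add β₁ β₂ h₁ h₂ => rw [add_lie, lie_add, h₁, h₂, add_zero]
    | tmul c z =>
      rw [leibniz_lie, hv a ha, lie_zero, add_zero, LieAlgebra.ExtendScalars.bracket_tmul]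
      exact hv _ (Ideal.mul_mem_right c _ ha) _
  intro a ha y
  ext v
  have hv : v ∈ p := by rw [htop]; trivial
  exact (hp v).1 hv a ha y

end WeylModule

/-! ### Twisting the action at one point by diagram and inner automorphisms. -/

section Twist

attribute [local instance 100] LieRing.ofAssociativeRing

variable {k 𝔤 : Type*} [Field k] [LieRing 𝔤] [LieAlgebra k 𝔤]
  {ι : Type*} [Finite ι] {H : LieSubalgebra k 𝔤} {b : LieAlgebra.Basis ι H}
  {A : Type*} [CommRing A] [Algebra k A]

/-- The map that is the identity where `e` vanishes and `g ⊗ θ` where `e` equals `1`. -/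
noncomputable def twist (e : A) (g : A →ₐ[k] A) (θ : 𝔤 →ₗ[k] 𝔤) : A ⊗[k] 𝔤 →ₗ[k] A ⊗[k] 𝔤 :=
  TensorProduct.map (LinearMap.mulLeft k (1 - e)) LinearMap.id +
    TensorProduct.map (LinearMap.mulLeft k e ∘ₗ g.toLinearMap) θ

theorem twist_tmul (e : A) (g : A →ₐ[k] A) (θ : 𝔤 →ₗ[k] 𝔤) (a : A) (y : 𝔤) :
    twist e g θ (a ⊗ₜ[k] y) = ((1 - e) * a) ⊗ₜ[k] y + (e * g a) ⊗ₜ[k] θ y := rfl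

theorem twist_id (e : A) (α : A ⊗[k] 𝔤) : twist e (AlgHom.id k A) LinearMap.id α = α := by
  induction α using TensorProduct.induction_on with
  | zero => rw [map_zero]
  | add α β hα hβ => rw [map_add, hα, hβ]
  | tmul a y =>
    rw [twist_tmul, AlgHom.id_apply, LinearMap.id_apply, ← TensorProduct.add_tmul]
    congr 1
    ring

theorem apply_tmul_eq_of_sub_mem {N : Type*} [AddCommGroup N] [Module k N]
    {ρ : A ⊗[k] 𝔤 →ₗ[k] N} {J : Ideal A} (hJ : ∀ a ∈ J, ∀ y : 𝔤, ρ (a ⊗ₜ[k] y) = 0)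
    {a c : A} (h : a - c ∈ J) (y : 𝔤) : ρ (a ⊗ₜ[k] y) = ρ (c ⊗ₜ[k] y) := by
  rw [← sub_eq_zero, ← map_sub, ← TensorProduct.sub_tmul]
  exact hJ _ h y

/-- The hypotheses say that, modulo `J`, `e₂` is concentrated where `e₁` is, and that `g₁` carries
`e₂` to a function equal to 1 there. So the cross terms die and the two twists compose at that one
point. -/
theorem apply_twist_twist {N : Type*} [AddCommGroup N] [Module k N]
    {ρ : A ⊗[k] 𝔤 →ₗ[k] N} {J : Ideal A} (hJ : ∀ a ∈ J, ∀ y : 𝔤, ρ (a ⊗ₜ[k] y) = 0)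
    {e₁ e₂ : A} {g₁ : A →ₐ[k] A} (h₁ : (1 - e₁) * e₂ ∈ J) (h₂ : e₁ * g₁ (1 - e₂) ∈ J)
    (g₂ : A →ₐ[k] A) (θ₁ θ₂ : 𝔤 →ₗ[k] 𝔤) (α : A ⊗[k] 𝔤) :
    ρ (twist e₁ g₁ θ₁ (twist e₂ g₂ θ₂ α)) = ρ (twist e₁ (g₁.comp g₂) (θ₁ ∘ₗ θ₂) α) := by
  induction α using TensorProduct.induction_on with
  | zero => simp only [map_zero]
  | add α β hα hβ => simp only [map_add, hα, hβ]
  | tmul a y =>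
    simp only [twist_tmul, map_add, AlgHom.comp_apply, LinearMap.comp_apply]
    rw [apply_tmul_eq_of_sub_mem hJ (c := (1 - e₁) * a) (a := (1 - e₁) * ((1 - e₂) * a)),
      hJ ((1 - e₁) * (e₂ * g₂ a)), hJ (e₁ * g₁ ((1 - e₂) * a)),
      apply_tmul_eq_of_sub_mem hJ (c := e₁ * g₁ (g₂ a)) (a := e₁ * g₁ (e₂ * g₂ a))]
    · abel
    · have : e₁ * g₁ (e₂ * g₂ a) - e₁ * g₁ (g₂ a) = -(g₁ (g₂ a)) * (e₁ * g₁ (1 - e₂)) := by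
        simp only [map_mul, map_sub, map_one]; ring
      rw [this]
      exact J.mul_mem_left _ h₂
    · rw [map_mul, ← mul_assoc]
      exact J.mul_mem_right _ h₂
    · rw [← mul_assoc]
      exact J.mul_mem_right _ h₁
    · have : (1 - e₁) * ((1 - e₂) * a) - (1 - e₁) * a = -a * ((1 - e₁) * e₂) := by ring
      rw [this]
      exact J.mul_mem_left _ h₁

/-- The twist by a Lie algebra homomorphism is a Lie algebra homomorphism modulo the annihilator. -/
noncomputable def twistedAct {N : Type*} [AddCommGroup N] [Module k N]
    (ρ : A ⊗[k] 𝔤 →ₗ⁅k⁆ Module.End k N) {J : Ideal A}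
    (hJ : ∀ a ∈ J, ∀ y : 𝔤, ρ (a ⊗ₜ[k] y) = 0) {e : A} (he : e * (1 - e) ∈ J)
    (g : A →ₐ[k] A) (δ : 𝔤 →ₗ⁅k⁆ 𝔤) : A ⊗[k] 𝔤 →ₗ⁅k⁆ Module.End k N :=
  { (ρ : A ⊗[k] 𝔤 →ₗ[k] Module.End k N) ∘ₗ twist e g (δ : 𝔤 →ₗ[k] 𝔤) with
    map_lie' := fun {α β} => by
      change ρ (twist e g (δ : 𝔤 →ₗ[k] 𝔤) ⁅α, β⁆) =
        ⁅ρ (twist e g (δ : 𝔤 →ₗ[k] 𝔤) α), ρ (twist e g (δ : 𝔤 →ₗ[k] 𝔤) β)⁆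
      rw [← LieHom.map_lie]
      induction α using TensorProduct.induction_on with
      | zero => simp only [map_zero, zero_lie]
      | add α₁ α₂ h₁ h₂ => simp only [map_add, add_lie, h₁, h₂]
      | tmul a y =>
        induction β using TensorProduct.induction_on with
        | zero => simp only [map_zero, lie_zero]
        | add β₁ β₂ h₁ h₂ => simp only [map_add, lie_add, h₁, h₂]
        | tmul c z =>
          have hJ' : ∀ a ∈ J, ∀ y : 𝔤,
            (ρ : A ⊗[k] 𝔤 →ₗ[k] Module.End k N) (a ⊗ₜ[k] y) = 0 := hJ
          have h1 := apply_tmul_eq_of_sub_mem hJ' (a := (1 - e) * a * ((1 - e) * c))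
            (c := (1 - e) * (a * c)) (by
              have : (1 - e) * a * ((1 - e) * c) - (1 - e) * (a * c) =
                -(a * c) * (e * (1 - e)) := by ring
              rw [this]; exact J.mul_mem_left _ he) ⁅y, z⁆
          have h2 := apply_tmul_eq_of_sub_mem hJ' (a := e * g a * (e * g c))
            (c := e * g (a * c)) (by
              have : e * g a * (e * g c) - e * g (a * c) = -(g a * g c) * (e * (1 - e)) := by
                rw [map_mul]; ring
              rw [this]; exact J.mul_mem_left _ he) (δ ⁅y, z⁆)
          have h3 := hJ ((1 - e) * a * (e * g c)) (by
              have : (1 - e) * a * (e * g c) = (a * g c) * (e * (1 - e)) := by ring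
              rw [this]; exact J.mul_mem_left _ he) ⁅y, δ z⁆
          have h4 := hJ (e * g a * ((1 - e) * c)) (by
              have : e * g a * ((1 - e) * c) = (g a * c) * (e * (1 - e)) := by ring
              rw [this]; exact J.mul_mem_left _ he) ⁅δ y, z⁆
          simp only [LieHom.coe_toLinearMap] at h1 h2
          simp only [LieAlgebra.ExtendScalars.bracket_tmul, twist_tmul, lie_add, add_lie, map_add,
            LieHom.coe_toLinearMap, ← LieHom.map_lie δ, h1, h2, h3, h4, add_zero, zero_add] }

theorem twistedAct_apply {N : Type*} [AddCommGroup N] [Module k N]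
    (ρ : A ⊗[k] 𝔤 →ₗ⁅k⁆ Module.End k N) {J : Ideal A}
    (hJ : ∀ a ∈ J, ∀ y : 𝔤, ρ (a ⊗ₜ[k] y) = 0) {e : A} (he : e * (1 - e) ∈ J)
    (g : A →ₐ[k] A) (δ : 𝔤 →ₗ⁅k⁆ 𝔤) (α : A ⊗[k] 𝔤) :
    twistedAct ρ hJ he g δ α = ρ (twist e g (δ : 𝔤 →ₗ[k] 𝔤) α) := rfl

/-- If `F ^ (j + 1)` is the least power killing `w`, applying `E` gives (j + 1)(m - j) = 0, so `j =
m`. Thus local nilpotency alone yields the sharp exponent. -/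
theorem pow_succ_apply_eq_zero_of_sl2 {V : Type*} [AddCommGroup V] [Module k V] [CharZero k]
    {E F K : Module.End k V} (hEF : E * F = F * E + K) (hKF : K * F = F * K - (2 : k) • F) {w : V}
    {m : ℕ} (hE : E w = 0) (hK : K w = (m : k) • w) {n : ℕ} (hn : (F ^ n) w = 0) :
    (F ^ (m + 1)) w = 0 := by
  have hK' : ∀ j : ℕ, K ((F ^ j) w) = (m - 2 * j : k) • (F ^ j) w := by
    intro j
    induction j with
    | zero => simpa using hK
    | succ j ih =>
      rw [pow_succ', Module.End.mul_apply, ← Module.End.mul_apply K, hKF, LinearMap.sub_apply,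
        Module.End.mul_apply, ih, LinearMap.smul_apply, map_smul, ← sub_smul]
      congr 1
      push_cast
      ring
  have hE' : ∀ j : ℕ, E ((F ^ (j + 1)) w) = ((j + 1) * (m - j) : k) • (F ^ j) w := by
    intro j
    induction j with
    | zero => rw [zero_add, pow_one, ← Module.End.mul_apply, hEF]; simp [hE, hK]
    | succ j ih =>
      rw [pow_succ', Module.End.mul_apply, ← Module.End.mul_apply E, hEF, LinearMap.add_apply,
        Module.End.mul_apply, ih, hK', map_smul, ← Module.End.mul_apply F, ← pow_succ', ← add_smul]
      congr 1
      push_cast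
      ring
  classical
  have hex : ∃ n, (F ^ n) w = 0 := ⟨n, hn⟩
  obtain ⟨j, hj⟩ : ∃ j, Nat.find hex = j := ⟨_, rfl⟩
  have hj0 := Nat.find_spec hex
  rw [hj] at hj0
  cases j with
  | zero => exact pow_apply_eq_zero_of_le (Nat.zero_le _) hj0
  | succ j =>
    have hne : (F ^ j) w ≠ 0 := Nat.find_min hex (by omega)
    have h1 := hE' j
    rw [hj0, map_zero, eq_comm, smul_eq_zero, or_iff_left hne, mul_eq_zero,
      or_iff_right (by exact_mod_cast j.succ_ne_zero), sub_eq_zero, Nat.cast_inj] at h1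
    rwa [h1]

theorem wt_apply (ψ : WeightFun b A) (h : H) :
    (wt ψ : Module.Dual k H) h = ψ.sum fun _ μ => (μ : Module.Dual k H) h := by
  simp only [wt, Finsupp.sum, AddSubmonoid.coe_finsetSum, LinearMap.sum_apply]

/-- The simple coroots span `H`. Diagram automorphisms and translates of weights are controlled only
on coroots, and this extends linear identities to `H`. -/
theorem h'_induction {p : H → Prop} (hh : ∀ i, p (b.h' i)) (h0 : p 0)
    (hadd : ∀ x y, p x → p y → p (x + y)) (hsmul : ∀ (c : k) x, p x → p (c • x)) (h : H) : p h := by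
  obtain ⟨x, hx⟩ := h
  have hx' : x ∈ Submodule.span k (Set.range b.h) := by
    rwa [← b.coe_cartan_eq_span]
  suffices ∀ hx, p ⟨x, hx⟩ from this hx
  clear hx
  have hmem : ∀ y ∈ Submodule.span k (Set.range b.h), y ∈ H := fun y hy => by
    rwa [← b.coe_cartan_eq_span] at hy
  induction hx' using Submodule.span_induction with
  | mem x hx => obtain ⟨i, rfl⟩ := hx; exact fun _ => hh i
  | zero => exact fun _ => h0
  | add x y hx hy hx' hy' => exact fun _ => hadd ⟨x, hmem x hx⟩ ⟨y, hmem y hy⟩ (hx' _) (hy' _)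
  | smul c x hx hx' => exact fun _ => hsmul c ⟨x, hmem x hx⟩ (hx' _)

theorem map_mem_borelUpper {σ : Equiv.Perm ι} {δ : 𝔤 ≃ₗ⁅k⁆ 𝔤} (hδ : IsDiagramAut b σ δ) {y : 𝔤}
    (hy : y ∈ b.borelUpper) : δ y ∈ b.borelUpper := by
  change y ∈ LieSubalgebra.lieSpan k 𝔤 (Set.range b.e) at hy
  change δ y ∈ LieSubalgebra.lieSpan k 𝔤 (Set.range b.e)
  induction hy using LieSubalgebra.lieSpan_induction with
  | mem y hy =>
    obtain ⟨i, rfl⟩ := hy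
    rw [(hδ i).1]
    exact LieSubalgebra.subset_lieSpan ⟨_, rfl⟩
  | zero => rw [map_zero]; exact zero_mem _
  | add y z _ _ hy hz => rw [map_add]; exact add_mem hy hz
  | smul c y _ hy => rw [map_smul]; exact LieSubalgebra.smul_mem _ c hy
  | lie y z _ _ hy hz => rw [LieEquiv.map_lie]; exact LieSubalgebra.lie_mem _ hy hz

theorem IsDiagramAut.map_h {σ : Equiv.Perm ι} {δ : 𝔤 ≃ₗ⁅k⁆ 𝔤} (hδ : IsDiagramAut b σ δ) (i : ι) :
    δ (b.h i) = b.h (σ i) := by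
  rw [← (b.sl2 i).lie_e_f, LieEquiv.map_lie, (hδ i).1, (hδ i).2, (b.sl2 (σ i)).lie_e_f]

theorem IsDiagramAut.symm {σ : Equiv.Perm ι} {δ : 𝔤 ≃ₗ⁅k⁆ 𝔤} (hδ : IsDiagramAut b σ δ) :
    IsDiagramAut b σ.symm δ.symm := fun i => by
  have h := hδ (σ.symm i)
  rw [Equiv.apply_symm_apply] at h
  exact ⟨by rw [← h.1, LieEquiv.symm_apply_apply], by rw [← h.2, LieEquiv.symm_apply_apply]⟩

/-- The map from a local Weyl module to the twist of another one by diagram automorphisms. -/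
theorem exists_twisted_linearMap [CharZero k] [FiniteDimensional k 𝔤] (ψ₁ ψ₂ : WeightFun b A)
    {J : Ideal A} (hJ : ∀ a ∈ J, ∀ y : 𝔤, weylAct ψ₂ (a ⊗ₜ[k] y) = 0) {e : A}
    (he : e * (1 - e) ∈ J) (g : A →ₐ[k] A) {σ : Equiv.Perm ι} {δ : 𝔤 ≃ₗ⁅k⁆ 𝔤}
    (hδ : IsDiagramAut b σ δ)
    (hwt : ∀ (a : A) (i : ι), (ψ₁.sum fun x μ => x a * (μ : Module.Dual k H) (b.h' i)) =
      (ψ₂.sum fun x μ => x ((1 - e) * a) * (μ : Module.Dual k H) (b.h' i)) +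
        ψ₂.sum fun x μ => x (e * g a) * (μ : Module.Dual k H) (b.h' (σ i))) :
    ∃ φ : WeylModule ψ₁ →ₗ[k] WeylModule ψ₂, φ (weylGen ψ₁) = weylGen ψ₂ ∧
      ∀ α v, φ ⁅α, v⁆ = ⁅twist e g (δ : 𝔤 →ₗ[k] 𝔤) α, φ v⁆ := by
  let ρ := twistedAct (weylAct ψ₂) hJ he g (δ : 𝔤 →ₗ⁅k⁆ 𝔤)
  have hρ : ∀ a y, ρ (a ⊗ₜ[k] y) = weylAct ψ₂ (((1 - e) * a) ⊗ₜ[k] y) +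
      weylAct ψ₂ ((e * g a) ⊗ₜ[k] δ y) := fun a y => by
    rw [twistedAct_apply, twist_tmul, map_add]; rfl
  have hE : ∀ (a : A), ∀ y ∈ b.borelUpper, ρ (a ⊗ₜ[k] y) (weylGen ψ₂) = 0 := by
    intro a y hy
    rw [hρ, LinearMap.add_apply, LieModule.toEnd_apply_apply, LieModule.toEnd_apply_apply,
      lie_weylGen_of_mem_borelUpper ψ₂ _ hy,
      lie_weylGen_of_mem_borelUpper ψ₂ _ (map_mem_borelUpper hδ hy), add_zero]
  have hH : ∀ (a : A) (h : H), ρ (a ⊗ₜ[k] (h : 𝔤)) (weylGen ψ₂) =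
      (ψ₁.sum fun x μ => x a * (μ : Module.Dual k H) h) • weylGen ψ₂ := by
    intro a h
    induction h using h'_induction (b := b) with
    | hh i =>
      have h1 : ((b.h' i : H) : 𝔤) = b.h i := rfl
      rw [hwt, hρ, h1, hδ.map_h, LinearMap.add_apply, weylAct_K_weylGen, weylAct_K_weylGen,
        add_smul]
    | h0 => simp
    | hadd x y hx hy =>
      rw [AddMemClass.coe_add, TensorProduct.tmul_add, map_add, LinearMap.add_apply, hx, hy,
        ← add_smul, ← Finsupp.sum_add]
      simp only [map_add, mul_add]
    | hsmul c x hx =>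
      rw [SetLike.val_smul, TensorProduct.tmul_smul, map_smul, LinearMap.smul_apply, hx,
        smul_smul, ← smul_eq_mul, Finsupp.smul_sum]
      simp only [map_smul, smul_eq_mul, mul_left_comm]
  refine exists_linearMap_weylModule ψ₁ ρ (weylGen ψ₂) hE (fun i m hm => ?_) hH
  -- The twisted `f i` is (1 - e) ⊗ f i + e ⊗ f (σ i). The two summands commute modulo `J`, as e (1
  -- - e) lies in `J`, and each is locally nilpotent; sl₂ theory then supplies the exponent demanded
  -- by ψ₁.
  have hloc : IsLocallyNilpotent (ρ (1 ⊗ₜ[k] b.f i)) := by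
    rw [hρ, (hδ i).2]
    refine (isLocallyNilpotent_weylAct_f ψ₂ _ i).add_of_commute
      (isLocallyNilpotent_weylAct_f ψ₂ _ (σ i)) ?_
    have h1 : (1 - e) * 1 * (e * g 1) = e * (1 - e) := by rw [map_one]; ring
    rw [Commute, SemiconjBy, toEnd_mul, LieAlgebra.ExtendScalars.bracket_tmul, h1, hJ _ he,
      add_zero]
  obtain ⟨n, hn⟩ := hloc (weylGen ψ₂)
  refine pow_succ_apply_eq_zero_of_sl2 (E := ρ (1 ⊗ₜ[k] b.e i)) (K := ρ (1 ⊗ₜ[k] b.h i)) ?_ ?_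
    (hE 1 _ (e_mem_borelUpper i)) ?_ hn
  · rw [toEnd_mul, LieAlgebra.ExtendScalars.bracket_tmul, (b.sl2 i).lie_e_f, mul_one]
  · rw [toEnd_mul, LieAlgebra.ExtendScalars.bracket_tmul, (b.sl2 i).lie_lie_smul_f k, mul_one,
      TensorProduct.tmul_neg, TensorProduct.tmul_smul, map_neg, map_smul, sub_eq_add_neg]
  · have h1 := hH 1 (b.h' i)
    rw [wt_apply] at hm
    simp only [map_one, one_mul, hm] at h1
    exact h1

/-- Inner automorphisms concentrated where `e` equals `1` are implemented on the Weyl module. -/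
theorem exists_linearEquiv_of_mem_innerAut [IsAlgClosed k] [CharZero k] [FiniteDimensional k 𝔤]
    (ψ : WeightFun b A) {J : Ideal A} (hJ : ∀ a ∈ J, ∀ y : 𝔤, weylAct ψ (a ⊗ₜ[k] y) = 0) {e : A}
    (he : e * (1 - e) ∈ J) {θ : 𝔤 ≃ₗ[k] 𝔤} (hθ : θ ∈ innerAut k 𝔤) :
    ∃ T : WeylModule ψ ≃ₗ[k] WeylModule ψ,
      ∀ α v, T ⁅α, v⁆ = ⁅twist e (AlgHom.id k A) (θ : 𝔤 →ₗ[k] 𝔤) α, T v⁆ := by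
  have hJ' : ∀ a ∈ J, ∀ y : 𝔤,
    (weylAct ψ : A ⊗[k] 𝔤 →ₗ[k] Module.End k (WeylModule ψ)) (a ⊗ₜ[k] y) = 0 := hJ
  have he' : (1 - e) * e ∈ J := by rwa [mul_comm]
  have htwist : ∀ (θ₁ θ₂ : 𝔤 →ₗ[k] 𝔤) (α : A ⊗[k] 𝔤) (v : WeylModule ψ),
      ⁅twist e (AlgHom.id k A) θ₁ (twist e (AlgHom.id k A) θ₂ α), v⁆ =
        ⁅twist e (AlgHom.id k A) (θ₁ ∘ₗ θ₂) α, v⁆ := fun θ₁ θ₂ α v =>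
    LinearMap.congr_fun (apply_twist_twist hJ' (g₁ := AlgHom.id k A) he' he (AlgHom.id k A)
      θ₁ θ₂ α) v
  induction hθ using Subgroup.closure_induction with
  | mem θ hθ =>
    obtain ⟨y, hy, hθ⟩ := hθ
    let ρ : 𝔤 →ₗ⁅k⁆ Module.End k (WeylModule ψ) :=
      { toFun := fun y => weylAct ψ (e ⊗ₜ[k] y)
        map_add' := fun y z => by rw [TensorProduct.tmul_add, map_add]
        map_smul' := fun c y => by rw [TensorProduct.tmul_smul, map_smul, RingHom.id_apply]
        map_lie' := fun {y z} => by
          rw [← LieHom.map_lie, LieAlgebra.ExtendScalars.bracket_tmul]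
          exact apply_tmul_eq_of_sub_mem hJ' (by
            have : e - e * e = e * (1 - e) := by ring
            rwa [this]) _ }
    have hloc : IsLocallyNilpotent (weylAct ψ (e ⊗ₜ[k] y)) :=
      isLocallyNilpotent_of_integrable b ρ (isLocallyNilpotent_weylAct_e ψ e)
        (isLocallyNilpotent_weylAct_f ψ e) hy
    have hL : IsLocallyNilpotent (LieAlgebra.ad k (A ⊗[k] 𝔤) (e ⊗ₜ[k] y)) :=
      .of_isNilpotent (isNilpotent_ad_tmul e hy)
    refine ⟨locExpEquiv hloc, fun α v => ?_⟩
    rw [locExpEquiv_apply, locExp_lie hL hloc, locExpEquiv_apply]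
    refine LinearMap.congr_fun (f := weylAct ψ (locExp hL α)) (g := weylAct ψ _) ?_ _
    induction α using TensorProduct.induction_on with
    | zero => simp only [map_zero]
    | add α β hα hβ => simp only [map_add, hα, hβ]
    | tmul a z =>
      have hN := pow_nilpotencyClass hy
      set N := nilpotencyClass (LieAlgebra.ad k 𝔤 y) with hNdef
      have hpow : ∀ n : ℕ, e ^ (n + 1) - e ∈ J := by
        intro n
        have h1 : e ^ (n + 1) - e = -e * (1 - e ^ n) := by ring
        obtain ⟨c, hc⟩ := one_sub_dvd_one_sub_pow e n
        rw [h1, hc]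
        have h2 : -e * ((1 - e) * c) = -c * (e * (1 - e)) := by ring
        rw [h2]
        exact J.mul_mem_left _ he
      -- Modulo `J` every positive power of `e` is `e`, so exp(ad(e ⊗ y)) sends a ⊗ z to e a ⊗
      -- exp(ad y) z, plus the correction (1 - e) a ⊗ z coming from degree 0. Truncating at `N + 1`
      -- keeps degree 0 in range even if `N = 0`.
      have hterm : ∀ (n : ℕ) (u : 𝔤), weylAct ψ ((e ^ n * a) ⊗ₜ[k] u) =
          weylAct ψ ((e * a) ⊗ₜ[k] u) +
            if n = 0 then weylAct ψ (((1 - e) * a) ⊗ₜ[k] u) else 0 := by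
        intro n u
        cases n with
        | zero =>
          rw [if_pos rfl, ← map_add, ← TensorProduct.add_tmul]
          congr 2
          ring
        | succ n =>
          rw [if_neg n.succ_ne_zero, add_zero]
          refine apply_tmul_eq_of_sub_mem hJ' ?_ u
          rw [← sub_mul]
          exact J.mul_mem_right _ (hpow n)
      have hN0 : N + 1 ≠ 0 := N.succ_ne_zero
      have hN1 : LieAlgebra.ad k 𝔤 y ^ (N + 1) = 0 := by rw [pow_succ, hN, zero_mul]
      rw [locExp_apply hL (N := N + 1) (by
        rw [ad_tmul_pow, hN1, LinearMap.zero_apply, TensorProduct.tmul_zero]), map_sum]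
      simp only [map_smul, ad_tmul_pow, hterm, smul_add, Finset.sum_add_distrib, smul_ite,
        smul_zero]
      rw [Finset.sum_ite_eq', if_pos (Finset.mem_range.2 N.succ_pos)]
      have hexp : θ z = ∑ n ∈ Finset.range (N + 1),
          ((n.factorial : k)⁻¹) • (LieAlgebra.ad k 𝔤 y ^ n) z := by
        have h1 : θ z = expAd k 𝔤 y z := LinearMap.congr_fun hθ z
        rw [h1, expAd, LinearMap.sum_apply, Finset.sum_range_succ, hN, LinearMap.zero_apply,
          smul_zero, add_zero]
        rfl
      rw [twist_tmul, AlgHom.id_apply, LinearEquiv.coe_coe, hexp, TensorProduct.tmul_sum, map_add,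
        map_sum]
      simp only [TensorProduct.tmul_smul, map_smul]
      rw [add_comm]
      simp
  | one => exact ⟨LinearEquiv.refl k _, fun α v => by
      have : ((1 : 𝔤 ≃ₗ[k] 𝔤) : 𝔤 →ₗ[k] 𝔤) = LinearMap.id := rfl
      rw [this, twist_id]; rfl⟩
  | mul θ₁ θ₂ _ _ h₁ h₂ =>
    obtain ⟨T₁, hT₁⟩ := h₁
    obtain ⟨T₂, hT₂⟩ := h₂
    refine ⟨T₂.trans T₁, fun α v => ?_⟩
    rw [LinearEquiv.trans_apply, hT₂, hT₁, htwist]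
    rfl
  | inv θ _ h =>
    obtain ⟨T, hT⟩ := h
    refine ⟨T.symm, fun α v => ?_⟩
    rw [LinearEquiv.symm_apply_eq, hT, LinearEquiv.apply_symm_apply, htwist]
    have : (θ : 𝔤 →ₗ[k] 𝔤) ∘ₗ ((θ⁻¹ : 𝔤 ≃ₗ[k] 𝔤) : 𝔤 →ₗ[k] 𝔤) = LinearMap.id := by
      ext z; exact θ.apply_symm_apply z
    rw [this, twist_id]

end Twist

/-! ### Moving one point of the support along its orbit. -/

section Step

variable {k 𝔤 : Type*} [Field k] [LieRing 𝔤] [LieAlgebra k 𝔤]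
  {ι : Type*} [Finite ι] {H : LieSubalgebra k 𝔤} {b : LieAlgebra.Basis ι H}
  {A : Type*} [CommRing A] [Algebra k A]

theorem sum_add_single (χ : WeightFun b A) (x : RatPoint k A) (μ : dominantWeights b)
    (q : RatPoint k A → k) (h : H) :
    ((χ + Finsupp.single x μ).sum fun z ν => q z * (ν : Module.Dual k H) h) =
      (χ.sum fun z ν => q z * (ν : Module.Dual k H) h) + q x * (μ : Module.Dual k H) h := by
  rw [Finsupp.sum_add_index', Finsupp.sum_single_index]
  · simp
  · simp
  · intro z ν ν'
    simp [mul_add]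

theorem sum_eq_sum_add_sum_of_twist (χ : WeightFun b A) {x x' : RatPoint k A}
    {μ ν : dominantWeights b} {e : A} {g : A →ₐ[k] A} {σ : Equiv.Perm ι}
    (hx' : x' e = 1) (hχ : ∀ z ∈ χ.support, z e = 0) (hg : ∀ a, x' (g a) = x a)
    (hμ : ∀ i, (ν : Module.Dual k H) (b.h' (σ i)) = (μ : Module.Dual k H) (b.h' i))
    (a : A) (i : ι) :
    ((χ + Finsupp.single x μ).sum fun z ν => z a * (ν : Module.Dual k H) (b.h' i)) =
      ((χ + Finsupp.single x' ν).sum fun z ν =>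
        z ((1 - e) * a) * (ν : Module.Dual k H) (b.h' i)) +
      (χ + Finsupp.single x' ν).sum fun z ν =>
        z (e * g a) * (ν : Module.Dual k H) (b.h' (σ i)) := by
  rw [sum_add_single χ x μ (fun z => z a), sum_add_single χ x' ν (fun z => z ((1 - e) * a)),
    sum_add_single χ x' ν (fun z => z (e * g a))]
  have h1 : (χ.sum fun z ν => z ((1 - e) * a) * (ν : Module.Dual k H) (b.h' i)) =
      χ.sum fun z ν => z a * (ν : Module.Dual k H) (b.h' i) :=
    Finset.sum_congr rfl fun z hz => by simp [hχ z hz]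
  have h2 : (χ.sum fun z ν => z (e * g a) * (ν : Module.Dual k H) (b.h' (σ i))) = 0 :=
    Finset.sum_eq_zero fun z hz => by simp [hχ z hz]
  rw [h1, h2]
  simp [hx', hg, hμ]

theorem exists_separating (y : RatPoint k A) (Z : Finset (RatPoint k A)) (hy : y ∉ Z) :
    ∃ a : A, y a = 1 ∧ ∀ z ∈ Z, z a = 0 := by
  classical
  induction Z using Finset.induction_on with
  | empty => exact ⟨1, map_one y, by simp⟩
  | insert z Z _ ih =>
    simp only [Finset.mem_insert, not_or] at hy
    obtain ⟨a, ha, haZ⟩ := ih hy.2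
    obtain ⟨c, hc⟩ : ∃ c, y c ≠ z c := by
      by_contra! h
      exact hy.1 (AlgHom.ext h)
    refine ⟨a * ((y c - z c)⁻¹ • (c - algebraMap k A (z c))), ?_, fun z' hz' => ?_⟩
    · simp [ha, inv_mul_cancel₀ (sub_ne_zero.2 hc)]
    · rcases Finset.mem_insert.1 hz' with rfl | hz'
      · simp
      · simp [haZ z' hz']

/-- Lifting of idempotents: if t (1 - t) lies in `I`, then e (1 - e) lies in `I ^ M`. Divisibility,
rather than congruence, also controls products of `e` with translates of `1 - e`. -/
theorem exists_pow_dvd_pow_dvd (t : A) (M : ℕ) : ∃ e : A, t ^ M ∣ e ∧ (1 - t) ^ M ∣ 1 - e := by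
  refine ⟨1 - (1 - t ^ M) ^ M, ?_, ?_⟩
  · simpa using one_sub_dvd_one_sub_pow (1 - t ^ M) M
  · rw [sub_sub_cancel]
    exact pow_dvd_pow_of_dvd (one_sub_dvd_one_sub_pow t M) M

theorem mul_mem_pow_of_dvd {I : Ideal A} {s t c d : A} {M : ℕ} (h : s * t ∈ I) (hc : s ^ M ∣ c)
    (hd : t ^ M ∣ d) : c * d ∈ I ^ M :=
  Ideal.mem_of_dvd _ ((mul_pow s t M).symm ▸ mul_dvd_mul hc hd) (Ideal.pow_mem_pow h M)

theorem mem_supportIdeal_add_single (χ : WeightFun b A) (x : RatPoint k A) (μ : dominantWeights b)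
    {a : A} (hχ : ∀ z ∈ χ.support, z a = 0) (hx : x a = 0) :
    a ∈ supportIdeal (χ + Finsupp.single x μ) := by
  classical
  rw [mem_supportIdeal]
  intro z hz
  rcases Finset.mem_union.1 (Finsupp.support_add hz) with h | h
  · exact hχ z h
  · rw [Finset.mem_singleton.1 (Finsupp.support_single_subset h), hx]

/-- The composite fixes the generator, and the two twists cancel modulo `J`, so it is linear over `A
⊗ 𝔤`. -/
theorem comp_eq_id_of_semilinear {ψ₁ ψ₂ : WeightFun b A} {J : Ideal A}
    (hJ : ∀ a ∈ J, ∀ y : 𝔤, weylAct ψ₁ (a ⊗ₜ[k] y) = 0) {e e' : A} {g g' : A →ₐ[k] A}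
    {δ δ' : 𝔤 →ₗ[k] 𝔤} (h₁ : (1 - e') * e ∈ J) (h₂ : e' * g' (1 - e) ∈ J)
    (hg : g'.comp g = AlgHom.id k A) (hδ : δ' ∘ₗ δ = LinearMap.id)
    {φ : WeylModule ψ₁ →ₗ[k] WeylModule ψ₂} {φ' : WeylModule ψ₂ →ₗ[k] WeylModule ψ₁}
    (hφ : φ (weylGen ψ₁) = weylGen ψ₂) (hφ' : φ' (weylGen ψ₂) = weylGen ψ₁)
    (h : ∀ α v, φ ⁅α, v⁆ = ⁅twist e g δ α, φ v⁆)
    (h' : ∀ α v, φ' ⁅α, v⁆ = ⁅twist e' g' δ' α, φ' v⁆) : φ' ∘ₗ φ = LinearMap.id := by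
  have htop := eq_top_of_weylGen_mem ψ₁ (LinearMap.eqLocus (φ' ∘ₗ φ) LinearMap.id)
    (by simp [LinearMap.mem_eqLocus, hφ, hφ']) (fun α v hv => by
      rw [LinearMap.mem_eqLocus, LinearMap.comp_apply, LinearMap.id_apply] at hv ⊢
      rw [h, h', hv]
      have := LinearMap.congr_fun (apply_twist_twist
        (ρ := (weylAct ψ₁ : A ⊗[k] 𝔤 →ₗ[k] Module.End k (WeylModule ψ₁))) hJ h₁ h₂ g δ' δ α) v
      rw [hg, hδ, twist_id] at this
      exact this)
  exact LinearMap.eqLocus_eq_top.1 htop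

variable {Γ : Type*} [Group Γ] [MulSemiringAction Γ A] [SMulCommClass Γ k A]
  [DistribMulAction Γ 𝔤] [SMulCommClass Γ k 𝔤] [IsLieAction Γ 𝔤]

/-- Here the twist of β is (1 - e) β + e (γ β), which is β when γ β = β, whatever `e` is. -/
theorem twist_actLie_of_mem {α : A ⊗[k] 𝔤} (hα : α ∈ equivariantMapAlgebra k A 𝔤 Γ) (e : A)
    (γ : Γ) : twist e (MulSemiringAction.toAlgHom k A γ) (actLie k 𝔤 γ : 𝔤 →ₗ[k] 𝔤) α = α := by
  have h : ∀ β : A ⊗[k] 𝔤,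
      twist e (MulSemiringAction.toAlgHom k A γ) (actLie k 𝔤 γ : 𝔤 →ₗ[k] 𝔤) β =
        (1 - e) • β + e • diagAct k A 𝔤 γ β := by
    intro β
    induction β using TensorProduct.induction_on with
    | zero => simp only [map_zero, smul_zero, add_zero]
    | add β₁ β₂ h₁ h₂ =>
      simp only [map_add, smul_add, h₁, h₂]
      abel
    | tmul a y => rfl
  rw [h, hα γ, ← add_smul, sub_add_cancel, one_smul]

/-- Moving one point of the support by an element of the group does not change the restriction of
the local Weyl module to the equivariant map algebra. -/
theorem nonempty_equiv_add_single [IsAlgClosed k] [CharZero k] [FiniteDimensional k 𝔤]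
    (χ : WeightFun b A) (x : RatPoint k A) (γ : Γ) (μ ν : dominantWeights b)
    (hμν : IsOuterTranslate b (fun y => γ • y) μ ν) (hx : x ∉ χ.support)
    (hγx : γ • x ∉ χ.support) :
    Nonempty (WeylModule (χ + Finsupp.single x μ) ≃ₗ⁅k, equivariantMapAlgebra k A 𝔤 Γ⁆
      WeylModule (χ + Finsupp.single (γ • x) ν)) := by
  classical
  obtain ⟨σ, ⟨δ, hδ, θ, hθ, hγ⟩, hσ⟩ := hμν
  set ψ₁ := χ + Finsupp.single x μ with hψ₁
  set ψ₂ := χ + Finsupp.single (γ • x) ν with hψ₂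
  obtain ⟨M₁, hM₁⟩ := exists_pow_supportIdeal_annihilates ψ₁
  obtain ⟨M₂, hM₂⟩ := exists_pow_supportIdeal_annihilates ψ₂
  -- The added 1 makes `M` nonzero, so that a zero of `s` is a zero of every multiple of `s ^ M`.
  set M := max M₁ M₂ + 1 with hM
  have hM0 : M ≠ 0 := Nat.succ_ne_zero _
  have hJ₁ := hM₁ M (by omega)
  have hJ₂ := hM₂ M (by omega)
  -- Vanishing on the translated support makes `γ⁻¹ • t` vanish on the support of χ, while its value
  -- at `x` is 1: it plays for ψ₁ the role that `t` plays for ψ₂.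
  obtain ⟨t, ht, htZ⟩ := exists_separating (γ • x) (χ.support ∪ χ.support.image (γ • ·)) (by
    simp only [Finset.mem_union, Finset.mem_image, not_or, not_exists, not_and]
    exact ⟨hγx, fun z hz h => hx (by rwa [← smul_left_cancel γ h])⟩)
  obtain ⟨e, hte, hte'⟩ := exists_pow_dvd_pow_dvd t M
  have hpt : ∀ (z : RatPoint k A) (a : A), z (γ⁻¹ • a) = (γ • z) a := fun z a => rfl
  set t' := γ⁻¹ • t with ht'
  set e' := γ⁻¹ • e with he'
  have hte₁ : t' ^ M ∣ e' := by
    rw [ht', he', ← smul_pow']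
    exact map_dvd (MulSemiringAction.toRingHom Γ A γ⁻¹) hte
  have hte₁' : (1 - t') ^ M ∣ 1 - e' := by
    have : ∀ c : A, 1 - γ⁻¹ • c = γ⁻¹ • (1 - c) := fun c => by rw [smul_sub, smul_one]
    rw [ht', he', this, this, ← smul_pow']
    exact map_dvd (MulSemiringAction.toRingHom Γ A γ⁻¹) hte'
  have htχ : ∀ z ∈ χ.support, z t = 0 := fun z hz => htZ z (Finset.mem_union_left _ hz)
  have htχ' : ∀ z ∈ χ.support, z t' = 0 := fun z hz =>
    htZ _ (Finset.mem_union_right _ (Finset.mem_image_of_mem _ hz))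
  have htx : x t' = 1 := ht
  have hev0 : ∀ (z : RatPoint k A) (s c : A), s ^ M ∣ c → z s = 0 → z c = 0 := by
    rintro z s _ ⟨d, rfl⟩ hs
    rw [map_mul, map_pow, hs, zero_pow hM0, zero_mul]
  have hev1 : ∀ (z : RatPoint k A) (s c : A), (1 - s) ^ M ∣ 1 - c → z s = 1 → z c = 1 := by
    intro z s c h hs
    have := hev0 z (1 - s) (1 - c) h (by rw [map_sub, map_one, hs, sub_self])
    rw [map_sub, map_one, sub_eq_zero] at this
    exact this.symm
  have m₁ : e' * (1 - e') ∈ supportIdeal ψ₁ ^ M := mul_mem_pow_of_dvd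
    (mem_supportIdeal_add_single χ x μ (fun z hz => by rw [map_mul, htχ' z hz, zero_mul])
      (by rw [map_mul, map_sub, map_one, htx, sub_self, mul_zero])) hte₁ hte₁'
  have m₂ : (1 - e') * e ∈ supportIdeal ψ₁ ^ M := mul_mem_pow_of_dvd
    (mem_supportIdeal_add_single χ x μ (fun z hz => by rw [map_mul, htχ z hz, mul_zero])
      (by rw [map_mul, map_sub, map_one, htx, sub_self, zero_mul])) hte₁' hte
  have m₃ : e * (1 - e) ∈ supportIdeal ψ₂ ^ M := mul_mem_pow_of_dvd
    (mem_supportIdeal_add_single χ (γ • x) ν (fun z hz => by rw [map_mul, htχ z hz, zero_mul])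
      (by rw [map_mul, map_sub, map_one, ht, sub_self, mul_zero])) hte hte'
  have m₄ : (1 - e) * e' ∈ supportIdeal ψ₂ ^ M := mul_mem_pow_of_dvd
    (mem_supportIdeal_add_single χ (γ • x) ν (fun z hz => by rw [map_mul, htχ' z hz, mul_zero])
      (by rw [map_mul, map_sub, map_one, ht, sub_self, zero_mul])) hte' hte₁
  set g := MulSemiringAction.toAlgHom k A γ with hg
  set g' := MulSemiringAction.toAlgHom k A γ⁻¹ with hg'
  have hgapp : ∀ a, g a = γ • a := fun a => rfl
  have hgapp' : ∀ a, g' a = γ⁻¹ • a := fun a => rfl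
  obtain ⟨φ, hφ, hφl⟩ := exists_twisted_linearMap ψ₁ ψ₂ hJ₂ m₃ g hδ
    (sum_eq_sum_add_sum_of_twist χ (hev1 _ t e hte' ht) (fun z hz => hev0 z t e hte (htχ z hz))
      (fun a => by rw [← hpt, hgapp, inv_smul_smul]) hσ)
  obtain ⟨φ', hφ', hφl'⟩ := exists_twisted_linearMap ψ₂ ψ₁ hJ₁ m₁ g' hδ.symm
    (sum_eq_sum_add_sum_of_twist χ (hev1 _ t' e' hte₁' htx)
      (fun z hz => hev0 z t' e' hte₁ (htχ' z hz)) (fun a => rfl)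
      (fun i => by rw [← hσ, Equiv.apply_symm_apply]))
  have hc₁ : φ' ∘ₗ φ = LinearMap.id := comp_eq_id_of_semilinear hJ₁ m₂
    (by rw [hgapp', smul_sub, smul_one]; exact m₁)
    (by ext a; exact inv_smul_smul γ a) (by ext y; exact δ.symm_apply_apply y) hφ hφ' hφl hφl'
  have hc₂ : φ ∘ₗ φ' = LinearMap.id := comp_eq_id_of_semilinear hJ₂ m₄
    (by rw [hgapp, smul_sub, smul_one, he', smul_inv_smul]; exact m₃)
    (by ext a; exact smul_inv_smul γ a) (by ext y; exact δ.apply_symm_apply y) hφ' hφ hφl' hφl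
  obtain ⟨T, hT⟩ := exists_linearEquiv_of_mem_innerAut ψ₂ hJ₂ m₃ hθ
  let Φ : WeylModule ψ₁ ≃ₗ[k] WeylModule ψ₂ := LinearEquiv.ofLinearMap φ φ' hc₂ hc₁
  refine ⟨{ Φ.trans T with map_lie' := fun {α v} => ?_ }⟩
  change T (φ ⁅(α : A ⊗[k] 𝔤), v⁆) = ⁅(α : A ⊗[k] 𝔤), T (φ v)⁆
  have h1 := LinearMap.congr_fun (apply_twist_twist
    (ρ := (weylAct ψ₂ : A ⊗[k] 𝔤 →ₗ[k] Module.End k (WeylModule ψ₂))) hJ₂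
    (g₁ := AlgHom.id k A) (by rwa [mul_comm]) m₃ g (θ : 𝔤 →ₗ[k] 𝔤) (δ : 𝔤 →ₗ[k] 𝔤)
    (α : A ⊗[k] 𝔤)) (T (φ v))
  have h2 : (θ : 𝔤 →ₗ[k] 𝔤) ∘ₗ (δ : 𝔤 →ₗ[k] 𝔤) = (actLie k 𝔤 γ : 𝔤 →ₗ[k] 𝔤) := by
    ext y; exact (hγ y).symm
  rw [AlgHom.id_comp, h2, hg, twist_actLie_of_mem α.2] at h1
  rw [hφl, hT]
  exact h1

end Step

/-! ### Systems of orbit representatives. -/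

section Reps

variable {k 𝔤 : Type*} [Field k] [LieRing 𝔤] [LieAlgebra k 𝔤]
  {ι : Type*} [Finite ι] {H : LieSubalgebra k 𝔤} {b : LieAlgebra.Basis ι H}
  {A : Type*} [CommRing A] [Algebra k A]

theorem restrictTo_insert (ψ : WeightFun b A) {x : RatPoint k A} {t : Set (RatPoint k A)}
    (hx : x ∉ t) : restrictTo ψ (insert x t) = restrictTo ψ t + Finsupp.single x (ψ x) := by
  classical
  ext1 z
  rw [Finsupp.add_apply, restrictTo, restrictTo, Finsupp.filter_apply, Finsupp.filter_apply,
    Finsupp.single_apply]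
  by_cases hzx : x = z
  · subst hzx
    simp [hx]
  · have : z ∈ insert x t ↔ z ∈ t := by
      rw [Set.mem_insert_iff, or_iff_right (Ne.symm hzx)]
    simp only [this, if_neg hzx, add_zero]

theorem notMem_support_restrictTo (ψ : WeightFun b A) {x : RatPoint k A} {t : Set (RatPoint k A)}
    (hx : x ∉ t) : x ∉ (restrictTo ψ t).support := by
  classical
  rw [Finsupp.notMem_support_iff, restrictTo, Finsupp.filter_apply_neg _ _ hx]

theorem insert_diff_singleton_mem_orbitReps {Γ X : Type*} [Group Γ] [MulAction Γ X] {Y s : Set X}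
    (hs : s ∈ orbitReps Γ Y) {x x' : X} (hx : x ∈ s) (hx' : x' ∈ Y)
    (hxx' : x' ∈ MulAction.orbit Γ x) : insert x' (s \ {x}) ∈ orbitReps Γ Y := by
  refine ⟨Set.insert_subset hx' (Set.sdiff_subset.trans hs.1), fun y hy => ?_⟩
  obtain ⟨z, ⟨hzs, hzy⟩, huniq⟩ := hs.2 y hy
  have horb : x' ∈ MulAction.orbit Γ y ↔ x ∈ MulAction.orbit Γ y := by
    rw [← MulAction.orbit_eq_iff, MulAction.orbit_eq_iff.2 hxx', MulAction.orbit_eq_iff]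
  by_cases hzx : z = x
  · refine ⟨x', ⟨Set.mem_insert _ _, horb.2 (hzx ▸ hzy)⟩, ?_⟩
    rintro u ⟨rfl | ⟨hus, hux⟩, huy⟩
    · rfl
    · exact absurd ((huniq u ⟨hus, huy⟩).trans hzx) hux
  · refine ⟨z, ⟨Set.mem_insert_of_mem _ ⟨hzs, hzx⟩, hzy⟩, ?_⟩
    rintro u ⟨rfl | ⟨hus, _⟩, huy⟩
    · exact absurd (huniq x ⟨hx, horb.1 huy⟩).symm hzx
    · exact huniq u ⟨hus, huy⟩

theorem eq_of_subset_of_mem_orbitReps {Γ X : Type*} [Group Γ] [MulAction Γ X] {Y s s' : Set X}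
    (hs : s ∈ orbitReps Γ Y) (hs' : s' ∈ orbitReps Γ Y) (h : s ⊆ s') : s = s' := by
  refine h.antisymm fun y hy => ?_
  obtain ⟨z, ⟨hzs, hzy⟩, -⟩ := hs.2 y (hs'.1 hy)
  rwa [(hs'.2 y (hs'.1 hy)).unique ⟨hy, MulAction.mem_orbit_self y⟩ ⟨h hzs, hzy⟩]

/-- A chosen representative of each orbit in `X` lies in `Y` when the orbit meets `Y`, by
invariance. -/
theorem orbitReps_nonempty {Γ X : Type*} [Group Γ] [MulAction Γ X] {Y : Set X}
    (hY : ∀ (γ : Γ), ∀ x ∈ Y, γ • x ∈ Y) : (orbitReps Γ Y).Nonempty := by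
  let r : X → X := fun x => (Quotient.mk (MulAction.orbitRel Γ X) x).out
  have hr : ∀ x, r x ∈ MulAction.orbit Γ x := fun x =>
    MulAction.orbitRel_apply.1 (Quotient.mk_out (s := MulAction.orbitRel Γ X) x)
  refine ⟨{x ∈ Y | r x = x}, fun x hx => hx.1, fun y hy => ⟨r y, ⟨⟨?_, ?_⟩, hr y⟩, ?_⟩⟩
  · obtain ⟨γ, hγ⟩ := hr y
    rw [← hγ]
    exact hY γ y hy
  · exact congrArg Quotient.out (Quotient.sound (s := MulAction.orbitRel Γ X) (hr y))
  · rintro u ⟨⟨_, hu⟩, huy⟩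
    rw [← hu]
    exact congrArg Quotient.out (Quotient.sound (s := MulAction.orbitRel Γ X) huy)

variable {Γ : Type*} [Group Γ] [MulSemiringAction Γ A] [SMulCommClass Γ k A]
  [DistribMulAction Γ 𝔤]

theorem smul_mem_Supp {ψ : WeightFun b A} (hψ : IsEquivariant Γ ψ) (γ : Γ) {x : RatPoint k A}
    (hx : x ∈ Supp ψ) : γ • x ∈ Supp ψ := by
  intro h0
  obtain ⟨σ, -, hσ⟩ := hψ γ x
  refine hx (Subtype.ext (LinearMap.ext fun h => ?_))
  induction h using h'_induction (b := b) with
  | hh i => rw [← hσ, h0]; rfl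
  | h0 => rw [map_zero, map_zero]
  | hadd x y hx hy => rw [map_add, map_add, hx, hy]
  | hsmul c x hx => rw [map_smul, map_smul, hx]

/-- Induction on the number of points of `s` outside `s'`: such a point is exchanged for the point
of `s'` in its orbit, at the cost of one application of `nonempty_equiv_add_single`. -/
theorem nonempty_equiv_restrictTo [IsAlgClosed k] [CharZero k] [FiniteDimensional k 𝔤]
    [SMulCommClass Γ k 𝔤] [IsLieAction Γ 𝔤] {ψ : WeightFun b A} (hψ : IsEquivariant Γ ψ)
    {s s' : Set (RatPoint k A)} (hs : s ∈ orbitReps Γ (Supp ψ)) (hs' : s' ∈ orbitReps Γ (Supp ψ)) :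
    Nonempty (WeylModule (restrictTo ψ s) ≃ₗ⁅k, equivariantMapAlgebra k A 𝔤 Γ⁆
      WeylModule (restrictTo ψ s')) := by
  have hfin : ∀ t ∈ orbitReps Γ (Supp ψ), t.Finite := fun t ht =>
    (ψ.support.finite_toSet.subset fun x hx => Finsupp.mem_support_iff.2 hx).subset ht.1
  obtain ⟨n, hn⟩ : ∃ n, (s \ s').ncard = n := ⟨_, rfl⟩
  induction n using Nat.strong_induction_on generalizing s with
  | _ n ih =>
    by_cases hsub : s ⊆ s'
    · obtain rfl := eq_of_subset_of_mem_orbitReps hs hs' hsub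
      exact ⟨LieModuleEquiv.refl⟩
    · obtain ⟨x, hx, hx'⟩ := Set.not_subset.1 hsub
      obtain ⟨x', ⟨hx's, γ, hγ⟩, -⟩ := hs'.2 x (hs.1 hx)
      have hγ : γ • x = x' := hγ
      have hx'n : x' ∉ s \ {x} := by
        rintro ⟨h1, h2⟩
        exact h2 ((hs.2 x (hs.1 hx)).unique ⟨h1, γ, hγ⟩ ⟨hx, MulAction.mem_orbit_self x⟩)
      have hxn : x ∉ s \ {x} := fun h => h.2 rfl
      have hs₁ := insert_diff_singleton_mem_orbitReps hs hx (hs'.1 hx's) ⟨γ, hγ⟩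
      have hlt : (insert x' (s \ {x}) \ s').ncard < n := by
        have : insert x' (s \ {x}) \ s' = (s \ s') \ {x} := by
          rw [Set.insert_sdiff_of_mem _ hx's, Set.sdiff_sdiff_comm]
        rw [this, ← hn]
        exact Set.ncard_sdiff_singleton_lt_of_mem ⟨hx, hx'⟩ ((hfin s hs).subset Set.sdiff_subset)
      obtain ⟨e₂⟩ := ih _ hlt hs₁ rfl
      have h1 : restrictTo ψ s = restrictTo ψ (s \ {x}) + Finsupp.single x (ψ x) := by
        rw [← restrictTo_insert ψ hxn, Set.insert_sdiff_singleton, Set.insert_eq_of_mem hx]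
      have h2 := restrictTo_insert ψ hx'n
      rw [← hγ] at h2 hx'n e₂
      rw [h2] at e₂
      rw [h1]
      obtain ⟨e₁⟩ := nonempty_equiv_add_single (restrictTo ψ (s \ {x})) x γ (ψ x) (ψ (γ • x))
        (hψ γ x) (notMem_support_restrictTo ψ hxn) (notMem_support_restrictTo ψ hx'n)
      exact ⟨e₁.trans e₂⟩

end Reps

end EMA

theorem mainTheorem3 {k A 𝔤 Γ ι : Type*}
    [Field k] [IsAlgClosed k] [CharZero k]
    [CommRing A] [Algebra k A] [Algebra.FiniteType k A]
    [LieRing 𝔤] [LieAlgebra k 𝔤] [FiniteDimensional k 𝔤] [LieAlgebra.IsSemisimple k 𝔤]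
    [CommGroup Γ] [Finite Γ]
    [MulSemiringAction Γ A] [SMulCommClass Γ k A]
    [DistribMulAction Γ 𝔤] [SMulCommClass Γ k 𝔤] [EMA.IsLieAction Γ 𝔤]
    (hfree : ∀ (γ : Γ) (x : EMA.RatPoint k A), γ • x = x → γ = 1)
    [Finite ι] {H : LieSubalgebra k 𝔤} (b : LieAlgebra.Basis ι H)
    (ψ : EMA.WeightFun b A) (hψ : EMA.IsEquivariant Γ ψ) :
    (∀ s ∈ EMA.orbitReps Γ (EMA.Supp ψ), ∀ s' ∈ EMA.orbitReps Γ (EMA.Supp ψ),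
      Nonempty (EMA.WeylModule (EMA.restrictTo ψ s)
        ≃ₗ⁅k, EMA.equivariantMapAlgebra k A 𝔤 Γ⁆ EMA.WeylModule (EMA.restrictTo ψ s'))) ∧
    (EMA.orbitReps Γ (EMA.Supp ψ)).Nonempty ∧
    (∀ s ∈ EMA.orbitReps Γ (EMA.Supp ψ),
      Nonempty (EMA.TwistedWeylModule Γ ψ
        ≃ₗ⁅k, EMA.equivariantMapAlgebra k A 𝔤 Γ⁆ EMA.WeylModule (EMA.restrictTo ψ s))) := by
  have hne : (EMA.orbitReps Γ (EMA.Supp ψ)).Nonempty :=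
    EMA.orbitReps_nonempty fun γ _ hx => EMA.smul_mem_Supp hψ γ hx
  exact ⟨fun s hs s' hs' => EMA.nonempty_equiv_restrictTo hψ hs hs', hne,
    -- The set chosen in `TwistedWeylModule` is a system of representatives only because one exists.
    fun s hs => EMA.nonempty_equiv_restrictTo hψ (Classical.epsilon_spec hne) hs⟩
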